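/- Let $n\ge 0$, $\kappa=(\kappa_1,\dots,\kappa_n)$ with positive integers $\kappa_l$, and put $|x|_\kappa=\big(\sum_{l=1}^n|x^l|^{2/\kappa_l}\big)^{1/2}$ for $x\in\mathbb R^n$ and $\alpha\cdot\kappa=\sum_l\alpha_l\kappa_l$ for multi-indices $\alpha\in\mathbb N_0^n$. Let $\mathcal A,\mathcal B\subset\mathbb N_0^n$ be finite sets of multi-indices such that, for a fixed $m\in\mathbb N_0$, $(\alpha+\beta)\cdot\kappa=m$ for all $\alpha\in\mathcal A$, $\beta\in\mathcal B$, and let $\lambda>0$ and $\Lambda$ be real numbers. Write $D^\alpha=\partial_1^{\alpha_1}\cdots\partial_n^{\alpha_n}$. Then there is a constant $C\ge 0$, depending only on $n,\kappa,m,\mathcal A,\mathcal B,\lambda,\Lambda$, with the following property. Let $a_{\alpha\beta}\in\mathbb C$ ($\alpha\in\mathcal A$, $\beta\in\mathcal B$) be constants whose symbol $p(\xi)=\sum_{\alpha\in\mathcal A,\beta\in\mathcal B}a_{\alpha\beta}(i\xi)^{\alpha+\beta}$ satisfies the hypoellipticity condition $$\lambda|\xi|_\kappa^m\le|p(\xi)|\le\Lambda|\xi|_\kappa^m\qquad(\xi\in\mathbb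 R^n).$$ Let $u\in\mathcal S'(\mathbb R^n)$ solve $$Pu=\sum_{\alpha\in\mathcal A,\beta\in\mathcal B}a_{\alpha\beta}D^{\alpha+\beta}u=\sum_{\beta\in\mathcal B}D^\beta f_\beta$$ in the sense of distributions, where the $f_\beta$ are tempered distributions represented by complex-valued continuous functions of at most polynomial growth (again denoted $f_\beta$). Put $$\omega_f(\rho)=\sup_{|x-y|_\kappa\le\rho}\ \sum_{\beta\in\mathcal B}|f_\beta(x)-f_\beta(y)|\in[0,\infty],$$ and assume $\int_0^1\frac{\omega_f(\rho)}{\rho}\,d\rho<\infty$ and $\int_1^\infty\frac{\omega_f(\rho)}{\rho^2}\,d\rho<\infty$. Then for every $\alpha\in\mathbb N_0^n$ with $(\alpha+\beta)\cdot\kappa=m$ for all $\beta\in\mathcal B$ (in particular for every $\alpha\in\mathcal A$), the distribution $D^\alpha u$ is represented by a continuous function, and there is a polynomial $Q_\alpha$ with complex coefficients such that for all $x,y\in\mathbb R^n$ $$\big|[D^\alpha u(x)-Q_\alpha(x)]-[D^\alpha u(y)-Q_\alpha(y)]\big|\le C\left(\int_0^{|x-y|_\kappa}\frac{\omega_f(\rho)}{\rho}\,d\rho+|x-y|_\kappa\int_{|x-y|_\kappa}^\infty\frac{\omega_f(\rho)}{\rho^2}\,d\rho\right),$$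 where for $x=y$ the right-hand side is read as $0$. -/

import Mathlib

open MeasureTheory Set
open scoped NNReal ENNReal SchwartzMap LineDeriv

noncomputable section

namespace AnisotropicSchauder

/-- The weighted order `α · κ = ∑ l, α_l κ_l` of a multi-index. -/
def weightedOrder {n : ℕ} (κ α : Fin n → ℕ) : ℕ :=
  ∑ l, α l * κ l

/-- The quasi-norm `|x|_κ = (∑ l, |x_l|^(2/κ_l))^(1/2)`. -/
def quasiNorm {n : ℕ} (κ : Fin n → ℕ) (x : EuclideanSpace ℝ (Fin n)) : ℝ :=
  Real.sqrt (∑ l, |x l| ^ (2 / (κ l : ℝ)))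

/-- The partial derivative `D^α = ∂_1^{α_1} ⋯ ∂_n^{α_n}` of a tempered distribution. -/
def multiDeriv {n : ℕ} (α : Fin n → ℕ) (u : 𝓢'(EuclideanSpace ℝ (Fin n), ℂ)) :
    𝓢'(EuclideanSpace ℝ (Fin n), ℂ) :=
  (List.finRange n).foldr
    (fun l v => (fun w : 𝓢'(EuclideanSpace ℝ (Fin n), ℂ) =>
      ∂_{EuclideanSpace.single l (1 : ℝ)} w)^[α l] v) u

/-- The symbol `p(ξ) = ∑_{α ∈ 𝒜, β ∈ ℬ} a_{αβ} (iξ)^{α+β}`. -/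
def symbol {n : ℕ} (𝒜 ℬ : Finset (Fin n → ℕ)) (a : (Fin n → ℕ) → (Fin n → ℕ) → ℂ)
    (ξ : EuclideanSpace ℝ (Fin n)) : ℂ :=
  ∑ α ∈ 𝒜, ∑ β ∈ ℬ, a α β * ∏ l, (Complex.I * (ξ l : ℂ)) ^ (α l + β l)

/-- `P u = ∑_{α ∈ 𝒜, β ∈ ℬ} a_{αβ} D^{α+β} u`. -/
def constCoeffOp {n : ℕ} (𝒜 ℬ : Finset (Fin n → ℕ)) (a : (Fin n → ℕ) → (Fin n → ℕ) → ℂ)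
    (u : 𝓢'(EuclideanSpace ℝ (Fin n), ℂ)) : 𝓢'(EuclideanSpace ℝ (Fin n), ℂ) :=
  ∑ α ∈ 𝒜, ∑ β ∈ ℬ, a α β • multiDeriv (α + β) u

/-- The tempered distribution `T` is represented by the function `g`. -/
def IsRepresentedBy {n : ℕ} (T : 𝓢'(EuclideanSpace ℝ (Fin n), ℂ))
    (g : EuclideanSpace ℝ (Fin n) → ℂ) : Prop :=
  ∀ φ : 𝓢(EuclideanSpace ℝ (Fin n), ℂ),
    Integrable (fun x => φ x * g x) ∧ T φ = ∫ x, φ x * g x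

/-- `g` has at most polynomial growth. -/
def PolynomialGrowth {n : ℕ} (g : EuclideanSpace ℝ (Fin n) → ℂ) : Prop :=
  ∃ (K : ℝ) (N : ℕ), ∀ x, ‖g x‖ ≤ K * (1 + ‖x‖) ^ N

/-- `ω_f(ρ) = sup_{|x-y|_κ ≤ ρ} ∑_{β ∈ ℬ} |f_β(x) - f_β(y)|`, with values in `[0, ∞]`. -/
def oscillation {n : ℕ} (κ : Fin n → ℕ) (ℬ : Finset (Fin n → ℕ))
    (f : (Fin n → ℕ) → EuclideanSpace ℝ (Fin n) → ℂ) (ρ : ℝ) : ℝ≥0∞ :=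
  ⨆ (x : EuclideanSpace ℝ (Fin n)) (y : EuclideanSpace ℝ (Fin n))
    (_ : quasiNorm κ (x - y) ≤ ρ), ∑ β ∈ ℬ, ‖f β x - f β y‖ₑ

/-- `∫_0^r ω(ρ)/ρ dρ + r ∫_r^∞ ω(ρ)/ρ² dρ`. -/
def diniBound (ω : ℝ → ℝ≥0∞) (r : ℝ) : ℝ≥0∞ :=
  (∫⁻ ρ in Ioo 0 r, ω ρ / ENNReal.ofReal ρ) +
    ENNReal.ofReal r * ∫⁻ ρ in Ioi r, ω ρ / ENNReal.ofReal (ρ ^ 2)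

end AnisotropicSchauder

end

/-
Littlewood–Paley decomposition. Cut the Fourier side into the anisotropic annuli `|ξ|_κ ≈ 2^{-j}`.
On such an annulus one can divide by the symbol, so the corresponding piece of `D^α u` is the sum
over `β` of `f_β` convolved with a Schwartz kernel `k_β` dilated to scale `2^j`. The kernels have
mean zero and are bounded uniformly in the symbol, so the increments of the `j`-th piece between `x`
and `y` are at most a constant times `min(1, |x - y|_κ / 2^j) ω_f(2^j)`; summed over `j`, this is
the Dini bound. The sum of the pieces, renormalised to vanish at the origin, agrees with `D^α u` on
test functions whose Fourier transform is flat at the origin, so the two differ by a polynomial.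
-/

open MeasureTheory Set Filter Topology
open scoped NNReal ENNReal SchwartzMap LineDeriv FourierTransform

noncomputable section

namespace AnisotropicSchauder

lemma norm_le_norm_of_abs_le {ι : Type*} [Fintype ι] {x y : EuclideanSpace ℝ ι}
    (h : ∀ l, |x l| ≤ |y l|) : ‖x‖ ≤ ‖y‖ := by
  simp only [EuclideanSpace.norm_eq, Real.norm_eq_abs]
  exact Real.sqrt_le_sqrt <| Finset.sum_le_sum fun l _ =>
    pow_le_pow_left₀ (abs_nonneg _) (h l) 2

section dilation

variable {n : ℕ} {κ : Fin n → ℕ}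

/-- The anisotropic dilation `(x_l) ↦ (t^{κ_l} x_l)`, for which the quasi-norm `|·|_κ` is
homogeneous of degree one. -/
def dilation (κ : Fin n → ℕ) (t : ℝ) :
    EuclideanSpace ℝ (Fin n) →L[ℝ] EuclideanSpace ℝ (Fin n) :=
  LinearMap.toContinuousLinearMap
    { toFun := fun x => WithLp.toLp 2 (fun l => t ^ κ l * x l)
      map_add' := fun x y => by ext l; simp [mul_add]
      map_smul' := fun c x => by ext l; simp; ring }

@[simp] lemma dilation_apply (t : ℝ) (x : EuclideanSpace ℝ (Fin n)) (l : Fin n) :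
    dilation κ t x l = t ^ κ l * x l := rfl

lemma dilation_dilation (s t : ℝ) (x : EuclideanSpace ℝ (Fin n)) :
    dilation κ s (dilation κ t x) = dilation κ (s * t) x := by
  ext l; simp [mul_pow, mul_assoc]

lemma dilation_one (x : EuclideanSpace ℝ (Fin n)) : dilation κ 1 x = x := by
  ext l; simp

lemma inner_dilation_left (t : ℝ) (x y : EuclideanSpace ℝ (Fin n)) :
    inner ℝ (dilation κ t x) y = inner ℝ x (dilation κ t y) := by
  simp [PiLp.inner_apply, mul_left_comm, mul_assoc]

lemma mul_norm_le_norm_dilation (hκ : ∀ l, 0 < κ l) {t : ℝ} (ht : 1 ≤ t)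
    (x : EuclideanSpace ℝ (Fin n)) : t * ‖x‖ ≤ ‖dilation κ t x‖ := by
  rw [← norm_smul_of_nonneg (by positivity)]
  refine norm_le_norm_of_abs_le fun l => ?_
  simp only [PiLp.smul_apply, smul_eq_mul, dilation_apply, abs_mul, abs_pow]
  gcongr
  exact le_self_pow₀ (ht.trans (le_abs_self t)) (hκ l).ne'

lemma norm_dilation_apply_le (hκ : ∀ l, 0 < κ l) {t : ℝ} (h0 : 0 ≤ t) (h1 : t ≤ 1)
    (x : EuclideanSpace ℝ (Fin n)) : ‖dilation κ t x‖ ≤ t * ‖x‖ := by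
  rw [← norm_smul_of_nonneg h0]
  refine norm_le_norm_of_abs_le fun l => ?_
  simp only [PiLp.smul_apply, smul_eq_mul, dilation_apply, abs_mul, abs_pow, abs_of_nonneg h0]
  gcongr
  exact pow_le_of_le_one h0 h1 (hκ l).ne'

lemma norm_dilation_le_pow {t : ℝ} (ht : 1 ≤ t) : ‖dilation κ t‖ ≤ t ^ (∑ l, κ l) := by
  have ht0 : 0 ≤ t := by positivity
  refine ContinuousLinearMap.opNorm_le_bound _ (by positivity) fun x => ?_
  rw [← norm_smul_of_nonneg (by positivity)]
  refine norm_le_norm_of_abs_le fun l => ?_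
  simp only [PiLp.smul_apply, smul_eq_mul, dilation_apply, abs_mul, abs_pow, abs_of_nonneg ht0]
  gcongr
  exact Finset.single_le_sum (fun _ _ => Nat.zero_le _) (Finset.mem_univ l)

lemma norm_dilation_le_one (hκ : ∀ l, 0 < κ l) {t : ℝ} (h0 : 0 ≤ t) (h1 : t ≤ 1) :
    ‖dilation κ t‖ ≤ 1 :=
  ContinuousLinearMap.opNorm_le_bound _ zero_le_one fun x =>
    (norm_dilation_apply_le hκ h0 h1 x).trans (by gcongr)

end dilation

section quasiNorm

variable {n : ℕ} {κ : Fin n → ℕ}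

lemma quasiNorm_nonneg (x : EuclideanSpace ℝ (Fin n)) : 0 ≤ quasiNorm κ x := Real.sqrt_nonneg _

lemma quasiNorm_sq (x : EuclideanSpace ℝ (Fin n)) :
    quasiNorm κ x ^ 2 = ∑ l, |x l| ^ (2 / (κ l : ℝ)) :=
  Real.sq_sqrt (Finset.sum_nonneg fun _ _ => by positivity)

lemma pow_rpow_two_div {r : ℝ} (hr : 0 ≤ r) {k : ℕ} (hk : 0 < k) :
    (r ^ k) ^ (2 / (k : ℝ)) = r ^ 2 := by
  rw [← Real.rpow_natCast_mul hr, mul_div_cancel₀ _ (by positivity), Real.rpow_two]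

lemma quasiNorm_dilation (hκ : ∀ l, 0 < κ l) {t : ℝ} (ht : 0 ≤ t)
    (x : EuclideanSpace ℝ (Fin n)) : quasiNorm κ (dilation κ t x) = t * quasiNorm κ x := by
  rw [← sq_eq_sq₀ (quasiNorm_nonneg _) (mul_nonneg ht (quasiNorm_nonneg _)), mul_pow,
    quasiNorm_sq, quasiNorm_sq, Finset.mul_sum]
  refine Finset.sum_congr rfl fun l _ => ?_
  rw [dilation_apply, abs_mul, abs_pow, abs_of_nonneg ht,
    Real.mul_rpow (by positivity) (abs_nonneg _), pow_rpow_two_div ht (hκ l)]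

lemma abs_apply_le_quasiNorm_pow (hκ : ∀ l, 0 < κ l) (x : EuclideanSpace ℝ (Fin n)) (l : Fin n) :
    |x l| ≤ quasiNorm κ x ^ κ l := by
  have hq := quasiNorm_nonneg (κ := κ) x
  have hκl : (0 : ℝ) < 2 / κ l := div_pos two_pos (Nat.cast_pos.2 (hκ l))
  rw [← Real.rpow_le_rpow_iff (abs_nonneg _) (by positivity) hκl, pow_rpow_two_div hq (hκ l),
    quasiNorm_sq]
  exact Finset.single_le_sum (f := fun l => |x l| ^ (2 / (κ l : ℝ)))
    (fun _ _ => by positivity) (Finset.mem_univ l)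

lemma quasiNorm_le_mul_of_abs_le_pow (hκ : ∀ l, 0 < κ l) {x : EuclideanSpace ℝ (Fin n)} {r : ℝ}
    (hr : 0 ≤ r) (h : ∀ l, |x l| ≤ r ^ κ l) : quasiNorm κ x ≤ n * r := by
  refine Real.sqrt_le_iff.2 ⟨by positivity, ?_⟩
  calc ∑ l, |x l| ^ (2 / (κ l : ℝ)) ≤ ∑ _l : Fin n, r ^ 2 := by
        refine Finset.sum_le_sum fun l _ => ?_
        rw [← pow_rpow_two_div hr (hκ l)]
        exact Real.rpow_le_rpow (abs_nonneg _) (h l) (by positivity)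
    _ = n * r ^ 2 := by simp
    _ ≤ n ^ 2 * r ^ 2 := by gcongr; exact_mod_cast Nat.le_self_pow two_ne_zero n
    _ = (n * r) ^ 2 := (mul_pow _ _ _).symm

lemma quasiNorm_eq_zero_iff (hκ : ∀ l, 0 < κ l) {x : EuclideanSpace ℝ (Fin n)} :
    quasiNorm κ x = 0 ↔ x = 0 := by
  refine ⟨fun h => ?_, ?_⟩
  · ext l
    simpa [h, (hκ l).ne'] using abs_apply_le_quasiNorm_pow hκ x l
  · rintro rfl
    refine le_antisymm ?_ (quasiNorm_nonneg _)
    simpa using quasiNorm_le_mul_of_abs_le_pow hκ le_rfl (x := 0) (by simp)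

lemma continuous_quasiNorm : Continuous (quasiNorm κ) :=
  Real.continuous_sqrt.comp <| continuous_finsetSum _ fun l _ =>
    Continuous.rpow_const (by fun_prop) fun _ => Or.inr (by positivity)

lemma norm_le_of_quasiNorm_le_one (hκ : ∀ l, 0 < κ l) {x : EuclideanSpace ℝ (Fin n)}
    (h : quasiNorm κ x ≤ 1) : ‖x‖ ≤ n * quasiNorm κ x := by
  calc ‖x‖ = ‖∑ l, EuclideanSpace.single l (x l)‖ := by
        congr 1; ext l; simp [Finset.sum_apply, Pi.single_apply]
    _ ≤ ∑ l, |x l| := (norm_sum_le _ _).trans (by simp)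
    _ ≤ ∑ _l : Fin n, quasiNorm κ x := Finset.sum_le_sum fun l _ =>
        (abs_apply_le_quasiNorm_pow hκ x l).trans
          (pow_le_of_le_one (quasiNorm_nonneg _) h (hκ l).ne')
    _ = n * quasiNorm κ x := by simp

lemma quasiNorm_le_one_of_norm_le (hκ : ∀ l, 0 < κ l) {x : EuclideanSpace ℝ (Fin n)}
    (h : ‖x‖ ≤ (1 / (n + 1 : ℝ)) ^ (∑ l, κ l)) : quasiNorm κ x ≤ 1 := by
  have h1 : (1 / (n + 1 : ℝ)) ≤ 1 := div_le_one_of_le₀ (by simp) (by positivity)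
  calc quasiNorm κ x ≤ n * (1 / (n + 1 : ℝ)) := by
        refine quasiNorm_le_mul_of_abs_le_pow hκ (by positivity) fun l => ?_
        refine ((PiLp.norm_apply_le x l).trans h).trans (pow_le_pow_of_le_one (by positivity) h1 ?_)
        exact Finset.single_le_sum (fun _ _ => Nat.zero_le _) (Finset.mem_univ l)
    _ ≤ 1 := by
        rw [mul_one_div]
        exact div_le_one_of_le₀ (by simp) (by positivity)

lemma one_add_quasiNorm_le (hκ : ∀ l, 0 < κ l) (x : EuclideanSpace ℝ (Fin n)) :
    1 + quasiNorm κ x ≤ (n + 1) * (1 + ‖x‖) := by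
  have hle : quasiNorm κ x ≤ n * (1 + ‖x‖) :=
    quasiNorm_le_mul_of_abs_le_pow hκ (by positivity) fun l =>
      calc |x l| ≤ 1 + ‖x‖ := (PiLp.norm_apply_le x l).trans (by simp)
        _ ≤ (1 + ‖x‖) ^ κ l := le_self_pow₀ (by simp) (hκ l).ne'
  linarith [norm_nonneg x]

lemma tendsto_quasiNorm_sub (hκ : ∀ l, 0 < κ l) (x₀ : EuclideanSpace ℝ (Fin n)) :
    Tendsto (fun x => quasiNorm κ (x - x₀)) (𝓝 x₀) (𝓝 0) := by
  have hc : Continuous fun x => quasiNorm κ (x - x₀) :=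
    continuous_quasiNorm.comp (continuous_sub_right x₀)
  simpa only [sub_self, (quasiNorm_eq_zero_iff hκ).2] using hc.tendsto x₀

end quasiNorm

section modulus

variable {n : ℕ} {κ : Fin n → ℕ}

/-- The constant `G` in the bound `|g(x - δ_t y) - g(x)| ≤ G (1 + |y|) W`, valid whenever `W` bounds
the increments of `g` over `κ`-distances at most `t`; here `δ_t` is the anisotropic dilation. -/
def growthConst (κ : Fin n → ℕ) : ℝ := (n + 1 : ℝ) ^ (∑ l, κ l) + 2

lemma growthConst_nonneg : 0 ≤ growthConst κ := by unfold growthConst; positivity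

variable {F : Type*} [SeminormedAddCommGroup F] {g : EuclideanSpace ℝ (Fin n) → F} {t W : ℝ}

lemma norm_add_smul_sub_le {E : Type*} [AddCommGroup E] [Module ℝ E] {g : E → F} {v : E}
    (hg : ∀ x, ‖g (x + v) - g x‖ ≤ W) (x : E) (k : ℕ) :
    ‖g (x + (k : ℝ) • v) - g x‖ ≤ k * W := by
  induction k with
  | zero => simp
  | succ k ih =>
    have hstep : x + ((k + 1 : ℕ) : ℝ) • v = x + (k : ℝ) • v + v := by push_cast; module
    calc ‖g (x + ((k + 1 : ℕ) : ℝ) • v) - g x‖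
        ≤ ‖g (x + (k : ℝ) • v + v) - g (x + (k : ℝ) • v)‖ + ‖g (x + (k : ℝ) • v) - g x‖ := by
          rw [hstep]; exact norm_sub_le_norm_sub_add_norm_sub _ _ _
      _ ≤ W + k * W := add_le_add (hg _) ih
      _ = (k + 1 : ℕ) * W := by push_cast; ring

lemma norm_sub_dilation_sub_le (hκ : ∀ l, 0 < κ l) (ht : 0 ≤ t) (hW : 0 ≤ W)
    (hg : ∀ x y, quasiNorm κ (x - y) ≤ t → ‖g x - g y‖ ≤ W) (x y : EuclideanSpace ℝ (Fin n)) :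
    ‖g (x - dilation κ t y) - g x‖ ≤ growthConst κ * (1 + ‖y‖) * W := by
  -- The segment from `x` to `x - δ_t y` is cut into `N ≈ |y|` steps of quasi-norm at most `t`.
  set A : ℝ := (n + 1 : ℝ) ^ (∑ l, κ l) with hA
  have hA1 : 1 ≤ A := one_le_pow₀ (by simp)
  set N : ℕ := ⌈A * ‖y‖⌉₊ + 1 with hN
  have hN0 : (0 : ℝ) < N := by positivity
  have hle : A * ‖y‖ ≤ N := by
    rw [hN]; push_cast; linarith [Nat.le_ceil (A * ‖y‖)]
  have hN_le : (N : ℝ) ≤ growthConst κ * (1 + ‖y‖) := by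
    have := Nat.ceil_lt_add_one (show 0 ≤ A * ‖y‖ by positivity)
    rw [hN, growthConst, ← hA]
    push_cast
    nlinarith [norm_nonneg y]
  have hv : quasiNorm κ (dilation κ t ((-1 / (N : ℝ)) • y)) ≤ t := by
    rw [quasiNorm_dilation hκ ht]
    refine mul_le_of_le_one_right ht (quasiNorm_le_one_of_norm_le hκ ?_)
    rw [norm_smul, norm_div, norm_neg, norm_one, Real.norm_of_nonneg hN0.le, div_pow, one_pow,
      ← hA, one_div_mul_eq_div, div_le_div_iff₀ hN0 (by linarith)]
    linarith
  have hsteps : x + (N : ℝ) • dilation κ t ((-1 / (N : ℝ)) • y) = x - dilation κ t y := by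
    rw [← map_smul, smul_smul, mul_div_cancel₀ _ hN0.ne', neg_one_smul, map_neg, sub_eq_add_neg]
  calc ‖g (x - dilation κ t y) - g x‖ ≤ N * W :=
        hsteps ▸ norm_add_smul_sub_le (fun z => hg _ _ (by rwa [add_sub_cancel_left])) x N
    _ ≤ growthConst κ * (1 + ‖y‖) * W := by gcongr

end modulus

section oscillation

variable {n : ℕ} {κ : Fin n → ℕ} {ℬ : Finset (Fin n → ℕ)}
  {f : (Fin n → ℕ) → EuclideanSpace ℝ (Fin n) → ℂ}

lemma oscillation_mono : Monotone (oscillation κ ℬ f) := fun _ _ h =>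
  iSup₂_mono fun _ _ => iSup_mono' fun h' => ⟨h'.trans h, le_rfl⟩

lemma norm_sub_le_toReal_oscillation {ρ : ℝ} (hρ : oscillation κ ℬ f ρ ≠ ⊤) {β : Fin n → ℕ}
    (hβ : β ∈ ℬ) {x y : EuclideanSpace ℝ (Fin n)} (h : quasiNorm κ (x - y) ≤ ρ) :
    ‖f β x - f β y‖ ≤ (oscillation κ ℬ f ρ).toReal := by
  have hsum : ∑ β ∈ ℬ, ‖f β x - f β y‖ₑ ≤ oscillation κ ℬ f ρ :=
    le_iSup₂_of_le x y (le_iSup_of_le h le_rfl)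
  rw [← toReal_enorm]
  exact ENNReal.toReal_mono hρ ((Finset.single_le_sum (f := fun β => ‖f β x - f β y‖ₑ)
    (fun _ _ => zero_le) hβ).trans hsum)

end oscillation

section diniBound

variable {ω : ℝ → ℝ≥0∞} {r : ℝ}

lemma lintegral_min_mul_le_diniBound (hr : 0 < r) :
    ∫⁻ ρ in Ioi 0, ENNReal.ofReal (min (1 / ρ) (r / ρ ^ 2)) * ω ρ ≤ diniBound ω r := by
  have hnear : ∀ ρ ∈ Ioo 0 r,
      ENNReal.ofReal (min (1 / ρ) (r / ρ ^ 2)) * ω ρ ≤ ω ρ / ENNReal.ofReal ρ := fun ρ hρ => by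
    rw [ENNReal.div_eq_inv_mul, ← ENNReal.ofReal_inv_of_pos hρ.1, ← one_div]
    gcongr
    exact min_le_left _ _
  have hfar : ∀ ρ ∈ Ioi r, ENNReal.ofReal (min (1 / ρ) (r / ρ ^ 2)) * ω ρ
      ≤ ENNReal.ofReal r * (ω ρ / ENNReal.ofReal (ρ ^ 2)) := fun ρ hρ => by
    have hρ0 : 0 < ρ := hr.trans hρ
    rw [ENNReal.div_eq_inv_mul, ← ENNReal.ofReal_inv_of_pos (by positivity), ← mul_assoc,
      ← ENNReal.ofReal_mul hr.le, ← div_eq_mul_inv]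
    gcongr
    exact min_le_right _ _
  rw [← Ioo_union_Ici_eq_Ioi hr]
  refine (lintegral_union_le _ _ _).trans (add_le_add ?_ ?_)
  · exact setLIntegral_mono' measurableSet_Ioo hnear
  · rw [setLIntegral_congr Ioi_ae_eq_Ici.symm, ← lintegral_const_mul' _ _ ENNReal.ofReal_ne_top]
    exact setLIntegral_mono' measurableSet_Ioi hfar

lemma dyadic_term_le_setLIntegral (hω : Monotone ω) (hr : 0 < r) (j : ℤ) :
    ENNReal.ofReal (min 1 (r / 2 ^ j)) * ω (2 ^ j) ≤
      4 * ∫⁻ ρ in Ico ((2 : ℝ) ^ j) (2 ^ (j + 1)),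
        ENNReal.ofReal (min (1 / ρ) (r / ρ ^ 2)) * ω ρ := by
  have h2j : (0 : ℝ) < 2 ^ j := by positivity
  set s : ℝ := 2 ^ j
  have hs : (2 : ℝ) ^ (j + 1) = 2 * s := by rw [zpow_add_one₀ two_ne_zero, mul_comm]
  have hpoint : ∀ ρ ∈ Ico s (2 * s), ENNReal.ofReal (min 1 (r / s) / (4 * s)) * ω s ≤
      ENNReal.ofReal (min (1 / ρ) (r / ρ ^ 2)) * ω ρ := by
    rintro ρ ⟨hsρ, hρs⟩
    have hρ0 : 0 < ρ := h2j.trans_le hsρ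
    refine mul_le_mul' (ENNReal.ofReal_le_ofReal (le_min ?_ ?_)) (hω hsρ)
    · calc min 1 (r / s) / (4 * s) ≤ 1 / (4 * s) := by gcongr; exact min_le_left _ _
        _ ≤ 1 / ρ := by gcongr; linarith
    · calc min 1 (r / s) / (4 * s) ≤ r / s / (4 * s) := by gcongr; exact min_le_right _ _
        _ = r / (2 * s) ^ 2 := by field_simp; norm_num
        _ ≤ r / ρ ^ 2 := by gcongr
  have hvol : volume (Ico s (2 * s)) = ENNReal.ofReal s := by rw [Real.volume_Ico]; ring_nf
  calc ENNReal.ofReal (min 1 (r / s)) * ω s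
      = 4 * (ENNReal.ofReal (min 1 (r / s) / (4 * s)) * ω s * volume (Ico s (2 * s))) := by
        rw [hvol, mul_right_comm, ← mul_assoc, ← ENNReal.ofReal_mul (by positivity),
          show (4 : ℝ≥0∞) = ENNReal.ofReal 4 by norm_num, ← ENNReal.ofReal_mul (by norm_num)]
        congr 2
        field_simp
    _ ≤ _ := by
        rw [hs, ← setLIntegral_const]
        exact mul_le_mul' le_rfl (setLIntegral_mono' measurableSet_Ico hpoint)

lemma tsum_dyadic_le_diniBound (hω : Monotone ω) (hr : 0 < r) :
    ∑' j : ℤ, ENNReal.ofReal (min 1 (r / 2 ^ j)) * ω (2 ^ j) ≤ 4 * diniBound ω r := by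
  have hdisj : Pairwise (Function.onFun Disjoint fun j : ℤ => Ico ((2 : ℝ) ^ j) (2 ^ (j + 1))) :=
    (zpow_right_strictMono₀ (one_lt_two (α := ℝ))).monotone.pairwise_disjoint_on_Ico_succ
  have hpos : (⋃ j : ℤ, Ico ((2 : ℝ) ^ j) (2 ^ (j + 1))) ⊆ Ioi 0 :=
    iUnion_subset fun j ρ hρ => (show (0 : ℝ) < 2 ^ j by positivity).trans_le hρ.1
  calc ∑' j : ℤ, ENNReal.ofReal (min 1 (r / 2 ^ j)) * ω (2 ^ j)
      ≤ ∑' j : ℤ, 4 * ∫⁻ ρ in Ico ((2 : ℝ) ^ j) (2 ^ (j + 1)),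
          ENNReal.ofReal (min (1 / ρ) (r / ρ ^ 2)) * ω ρ :=
        ENNReal.tsum_le_tsum (dyadic_term_le_setLIntegral hω hr)
    _ = 4 * ∫⁻ ρ in ⋃ j : ℤ, Ico ((2 : ℝ) ^ j) (2 ^ (j + 1)),
          ENNReal.ofReal (min (1 / ρ) (r / ρ ^ 2)) * ω ρ := by
        rw [ENNReal.tsum_mul_left, lintegral_iUnion (fun _ => measurableSet_Ico) hdisj]
    _ ≤ 4 * diniBound ω r := by
        gcongr
        exact (lintegral_mono_set hpos).trans (lintegral_min_mul_le_diniBound hr)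

lemma tsum_dyadic_ne_top (hω : Monotone ω) (hfin : diniBound ω 1 ≠ ∞) :
    ∑' j : ℤ, ENNReal.ofReal (min 1 (1 / 2 ^ j)) * ω (2 ^ j) ≠ ∞ :=
  ne_top_of_le_ne_top (ENNReal.mul_ne_top (by simp) hfin) (tsum_dyadic_le_diniBound hω one_pos)

lemma zpow_ne_top_of_diniBound_ne_top (hω : Monotone ω) (hfin : diniBound ω 1 ≠ ∞) (j : ℤ) :
    ω (2 ^ j) ≠ ∞ := fun htop => by
  refine ENNReal.ne_top_of_tsum_ne_top (tsum_dyadic_ne_top hω hfin) j ?_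
  rw [htop, ENNReal.mul_top]
  simpa using zpow_pos two_pos j

lemma summable_dyadic (hω : Monotone ω) (hfin : diniBound ω 1 ≠ ∞) :
    Summable fun j : ℤ => min 1 (1 / (2 : ℝ) ^ j) * (ω (2 ^ j)).toReal := by
  refine (ENNReal.summable_toReal (tsum_dyadic_ne_top hω hfin)).congr fun j => ?_
  rw [ENNReal.toReal_mul, ENNReal.toReal_ofReal (by positivity)]

end diniBound

section weight

variable {n : ℕ}

/-- The integrable weight `(1 + |y|)^{-(n+1)}` on `ℝⁿ`. -/
def weight (n : ℕ) (y : EuclideanSpace ℝ (Fin n)) : ℝ := ((1 + ‖y‖) ^ (n + 1))⁻¹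

lemma weight_nonneg (y : EuclideanSpace ℝ (Fin n)) : 0 ≤ weight n y := by
  unfold weight; positivity

lemma integrable_weight : Integrable (weight n) := by
  refine (integrable_one_add_norm (E := EuclideanSpace ℝ (Fin n)) (μ := volume)
    (r := (n + 1 : ℕ)) (by simp)).congr (Eventually.of_forall fun y => ?_)
  simp only [weight]
  rw [Real.rpow_neg (by positivity), Real.rpow_natCast]

lemma le_mul_weight_of_pow_mul_le {r A : ℝ} {y : EuclideanSpace ℝ (Fin n)}
    (h : (1 + ‖y‖) ^ (n + 1) * r ≤ A) : r ≤ A * weight n y := by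
  rwa [weight, ← div_eq_mul_inv, le_div_iff₀ (by positivity), mul_comm]

end weight

section PolynomialGrowth

variable {n : ℕ} {κ : Fin n → ℕ} {h : EuclideanSpace ℝ (Fin n) → ℂ}

lemma integrable_norm_mul_one_add_pow (k : 𝓢(EuclideanSpace ℝ (Fin n), ℂ)) (N : ℕ) :
    Integrable fun y => ‖k y‖ * (1 + ‖y‖) ^ N := by
  refine ((k.integrable.norm.add (k.integrable_pow_mul volume N)).const_mul (2 ^ (N - 1))).mono'
    (by fun_prop) (Eventually.of_forall fun y => ?_)
  rw [Real.norm_of_nonneg (by positivity), Pi.add_apply]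
  calc ‖k y‖ * (1 + ‖y‖) ^ N ≤ ‖k y‖ * (2 ^ (N - 1) * (1 ^ N + ‖y‖ ^ N)) := by
        gcongr
        exact add_pow_le zero_le_one (norm_nonneg y) N
    _ = 2 ^ (N - 1) * (‖k y‖ + ‖y‖ ^ N * ‖k y‖) := by ring

lemma PolynomialGrowth.integrable_mul (hh : PolynomialGrowth h) (hc : Continuous h)
    (k : 𝓢(EuclideanSpace ℝ (Fin n), ℂ)) : Integrable fun y => k y * h y := by
  obtain ⟨K, N, hK⟩ := hh
  refine ((integrable_norm_mul_one_add_pow k N).const_mul K).mono'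
    (k.continuous.mul hc).aestronglyMeasurable (Eventually.of_forall fun y => ?_)
  calc ‖k y * h y‖ ≤ ‖k y‖ * (K * (1 + ‖y‖) ^ N) := by
        rw [norm_mul]
        gcongr
        exact hK y
    _ = K * (‖k y‖ * (1 + ‖y‖) ^ N) := by ring

lemma one_add_norm_sub_dilation_le (t : ℝ) (x y : EuclideanSpace ℝ (Fin n)) :
    1 + ‖x - dilation κ t y‖ ≤ (1 + ‖x‖) * ((1 + ‖dilation κ t‖) * (1 + ‖y‖)) := by
  have hsub : ‖x - dilation κ t y‖ ≤ ‖x‖ + ‖dilation κ t‖ * ‖y‖ :=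
    (norm_sub_le _ _).trans (add_le_add le_rfl ((dilation κ t).le_opNorm y))
  have hx := norm_nonneg x
  have hy := norm_nonneg y
  have hd := norm_nonneg (dilation κ t)
  nlinarith [mul_nonneg hd hy, mul_nonneg hx hy, mul_nonneg hx hd, mul_nonneg hx (mul_nonneg hd hy)]

end PolynomialGrowth

section dilationConv

variable {n : ℕ} {κ : Fin n → ℕ} {k g : EuclideanSpace ℝ (Fin n) → ℂ} {t W A : ℝ}

/-- The convolution `x ↦ ∫ k(y) g(x - δ_t y) dy` of `g` with the kernel `k` dilated to scale `t`;
with `t = 2^j` and a mean-zero kernel `k` it is a Littlewood–Paley piece of `g`. -/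
def dilationConv (κ : Fin n → ℕ) (k g : EuclideanSpace ℝ (Fin n) → ℂ) (t : ℝ)
    (x : EuclideanSpace ℝ (Fin n)) : ℂ :=
  ∫ y, k y * g (x - dilation κ t y)

lemma integrable_of_pow_mul_norm_le (hkc : Continuous k)
    (hk : ∀ y, (1 + ‖y‖) ^ (n + 2) * ‖k y‖ ≤ A) : Integrable k := by
  refine (integrable_weight.const_mul A).mono' hkc.aestronglyMeasurable
    (Eventually.of_forall fun y => le_mul_weight_of_pow_mul_le (le_trans ?_ (hk y)))
  gcongr <;> simp

lemma norm_mul_sub_dilation_le (hκ : ∀ l, 0 < κ l) (ht : 0 ≤ t) (hW : 0 ≤ W)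
    (hg : ∀ x y, quasiNorm κ (x - y) ≤ t → ‖g x - g y‖ ≤ W)
    (hk : ∀ y, (1 + ‖y‖) ^ (n + 2) * ‖k y‖ ≤ A) (x y : EuclideanSpace ℝ (Fin n)) :
    ‖k y * (g (x - dilation κ t y) - g x)‖ ≤ A * (growthConst κ * W) * weight n y := by
  have hG := growthConst_nonneg (κ := κ)
  refine le_mul_weight_of_pow_mul_le ?_
  calc (1 + ‖y‖) ^ (n + 1) * ‖k y * (g (x - dilation κ t y) - g x)‖
      ≤ (1 + ‖y‖) ^ (n + 1) * (‖k y‖ * (growthConst κ * (1 + ‖y‖) * W)) := by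
        rw [norm_mul]
        gcongr
        exact norm_sub_dilation_sub_le hκ ht hW hg x y
    _ = (1 + ‖y‖) ^ (n + 2) * ‖k y‖ * (growthConst κ * W) := by ring
    _ ≤ A * (growthConst κ * W) := by gcongr; exact hk y

lemma integrable_mul_sub_dilation (hκ : ∀ l, 0 < κ l) (ht : 0 ≤ t) (hW : 0 ≤ W)
    (hgc : Continuous g) (hg : ∀ x y, quasiNorm κ (x - y) ≤ t → ‖g x - g y‖ ≤ W)
    (hkc : Continuous k) (hk : ∀ y, (1 + ‖y‖) ^ (n + 2) * ‖k y‖ ≤ A)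
    (x : EuclideanSpace ℝ (Fin n)) :
    Integrable fun y => k y * (g (x - dilation κ t y) - g x) :=
  (integrable_weight.const_mul _).mono' (by fun_prop)
    (Eventually.of_forall (norm_mul_sub_dilation_le hκ ht hW hg hk x))

lemma integrable_mul_comp_sub_dilation (hκ : ∀ l, 0 < κ l) (ht : 0 ≤ t) (hW : 0 ≤ W)
    (hgc : Continuous g) (hg : ∀ x y, quasiNorm κ (x - y) ≤ t → ‖g x - g y‖ ≤ W)
    (hkc : Continuous k) (hk : ∀ y, (1 + ‖y‖) ^ (n + 2) * ‖k y‖ ≤ A)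
    (x : EuclideanSpace ℝ (Fin n)) : Integrable fun y => k y * g (x - dilation κ t y) :=
  ((integrable_mul_sub_dilation hκ ht hW hgc hg hkc hk x).add
    ((integrable_of_pow_mul_norm_le hkc hk).mul_const (g x))).congr
    (Eventually.of_forall fun y => by simp only [Pi.add_apply]; ring)

lemma norm_dilationConv_le (hκ : ∀ l, 0 < κ l) (ht : 0 ≤ t) (hW : 0 ≤ W)
    (hgc : Continuous g) (hg : ∀ x y, quasiNorm κ (x - y) ≤ t → ‖g x - g y‖ ≤ W)
    (hkc : Continuous k) (hk : ∀ y, (1 + ‖y‖) ^ (n + 2) * ‖k y‖ ≤ A) (hk0 : ∫ y, k y = 0)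
    (x : EuclideanSpace ℝ (Fin n)) :
    ‖dilationConv κ k g t x‖ ≤ A * (growthConst κ * ∫ y, weight n y) * W := by
  have hcancel : dilationConv κ k g t x = ∫ y, k y * (g (x - dilation κ t y) - g x) := by
    simp_rw [mul_sub]
    rw [integral_sub (integrable_mul_comp_sub_dilation hκ ht hW hgc hg hkc hk x)
      ((integrable_of_pow_mul_norm_le hkc hk).mul_const _), integral_mul_const, hk0, zero_mul,
      sub_zero, dilationConv]
  rw [hcancel]
  refine (norm_integral_le_of_norm_le (integrable_weight.const_mul _)
    (Eventually.of_forall (norm_mul_sub_dilation_le hκ ht hW hg hk x))).trans_eq ?_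
  rw [integral_const_mul]
  ring

lemma dilationConv_add_dilation (x η : EuclideanSpace ℝ (Fin n)) :
    dilationConv κ k g t (x + dilation κ t η) = dilationConv κ (fun y => k (y + η)) g t x := by
  rw [dilationConv, ← integral_add_right_eq_self _ η]
  simp only [dilationConv, map_add, add_sub_add_right_eq_sub]

lemma norm_sub_translate_le {E F : Type*} [NormedAddCommGroup E] [NormedSpace ℝ E]
    [NormedAddCommGroup F] [NormedSpace ℝ F] {k : E → F} (hkd : Differentiable ℝ k) {B R : ℝ}
    {L : ℕ} (hk : ∀ y, (1 + ‖y‖) ^ L * ‖fderiv ℝ k y‖ ≤ B) {η : E} (hη : ‖η‖ ≤ R) (y : E) :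
    (1 + ‖y‖) ^ L * ‖k (y + η) - k y‖ ≤ B * (R + 1) ^ L * ‖η‖ := by
  have hR : 0 ≤ R := (norm_nonneg η).trans hη
  have hderiv : ∀ z ∈ segment ℝ y (y + η),
      ‖fderiv ℝ k z‖ ≤ B * (R + 1) ^ L * ((1 + ‖y‖) ^ L)⁻¹ := fun z hz => by
    have hyz : ‖y - z‖ ≤ R := by
      obtain ⟨s, hs, rfl⟩ := (segment_eq_image' ℝ y (y + η)) ▸ hz
      rw [add_sub_cancel_left, sub_add_cancel_left, norm_neg, norm_smul, Real.norm_of_nonneg hs.1]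
      exact (mul_le_of_le_one_left (norm_nonneg _) hs.2).trans hη
    have hweight : 1 + ‖y‖ ≤ (R + 1) * (1 + ‖z‖) := by
      nlinarith [norm_le_insert' y z, mul_nonneg hR (norm_nonneg z)]
    rw [← div_eq_mul_inv, le_div_iff₀ (by positivity)]
    calc ‖fderiv ℝ k z‖ * (1 + ‖y‖) ^ L ≤ ‖fderiv ℝ k z‖ * ((R + 1) * (1 + ‖z‖)) ^ L := by gcongr
      _ = (1 + ‖z‖) ^ L * ‖fderiv ℝ k z‖ * (R + 1) ^ L := by rw [mul_pow]; ring
      _ ≤ _ := by gcongr; exact hk z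
  have hmean := (convex_segment y (y + η)).norm_image_sub_le_of_norm_fderiv_le
    (fun z _ => hkd z) hderiv (left_mem_segment ℝ _ _) (right_mem_segment ℝ _ _)
  rw [add_sub_cancel_left] at hmean
  calc _ ≤ (1 + ‖y‖) ^ L * (B * (R + 1) ^ L * ((1 + ‖y‖) ^ L)⁻¹ * ‖η‖) := by gcongr
    _ = _ := by field_simp

lemma norm_dilationConv_add_dilation_sub_le (hκ : ∀ l, 0 < κ l) (ht : 0 ≤ t) (hW : 0 ≤ W)
    (hgc : Continuous g) (hg : ∀ x y, quasiNorm κ (x - y) ≤ t → ‖g x - g y‖ ≤ W)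
    (hkd : Differentiable ℝ k) (hk : ∀ y, (1 + ‖y‖) ^ (n + 2) * ‖k y‖ ≤ A)
    (hk' : ∀ y, (1 + ‖y‖) ^ (n + 2) * ‖fderiv ℝ k y‖ ≤ A) {R : ℝ}
    {η : EuclideanSpace ℝ (Fin n)} (hη : ‖η‖ ≤ R) (x : EuclideanSpace ℝ (Fin n)) :
    ‖dilationConv κ k g t (x + dilation κ t η) - dilationConv κ k g t x‖ ≤
      A * (R + 1) ^ (n + 2) * ‖η‖ * (growthConst κ * ∫ y, weight n y) * W := by
  have hη_decay := norm_sub_translate_le hkd hk' hη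
  have hkc : Continuous k := hkd.continuous
  have hkint : Integrable k := integrable_of_pow_mul_norm_le hkc hk
  have hdiffc : Continuous fun y => k (y + η) - k y := by fun_prop
  have hdiff : dilationConv κ k g t (x + dilation κ t η) - dilationConv κ k g t x =
      dilationConv κ (fun y => k (y + η) - k y) g t x := by
    have hint := integrable_mul_comp_sub_dilation hκ ht hW hgc hg hkc hk x
    have hint' := integrable_mul_comp_sub_dilation hκ ht hW hgc hg hdiffc hη_decay x
    rw [dilationConv_add_dilation, sub_eq_iff_eq_add]
    simp only [dilationConv]
    rw [← integral_add hint' hint]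
    simp only [← add_mul, sub_add_cancel]
  rw [hdiff]
  refine norm_dilationConv_le hκ ht hW hgc hg hdiffc hη_decay ?_ x
  rw [integral_sub (hkint.comp_add_right η) hkint, integral_add_right_eq_self k, sub_self]

/-- The constant in the increment estimate `norm_dilationConv_sub_le` for the convolution with a
kernel which decays, with its gradient, like `B (1 + |y|)^{-(n+2)}`. -/
def dilationConvConst (κ : Fin n → ℕ) (B : ℝ) : ℝ :=
  2 * (B * (n + 1) ^ (n + 3)) * (growthConst κ * ∫ y, weight n y)

lemma dilationConvConst_nonneg (hA : 0 ≤ A) : 0 ≤ dilationConvConst κ A := by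
  have hG := growthConst_nonneg (κ := κ)
  have hw : 0 ≤ ∫ y, weight n y := integral_nonneg weight_nonneg
  unfold dilationConvConst
  positivity

lemma norm_dilationConv_sub_le (hκ : ∀ l, 0 < κ l) (ht : 0 < t) (hW : 0 ≤ W)
    (hgc : Continuous g) (hg : ∀ x y, quasiNorm κ (x - y) ≤ t → ‖g x - g y‖ ≤ W)
    (hkd : Differentiable ℝ k) (hk : ∀ y, (1 + ‖y‖) ^ (n + 2) * ‖k y‖ ≤ A)
    (hk' : ∀ y, (1 + ‖y‖) ^ (n + 2) * ‖fderiv ℝ k y‖ ≤ A) (hk0 : ∫ y, k y = 0)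
    (x x' : EuclideanSpace ℝ (Fin n)) :
    ‖dilationConv κ k g t x - dilationConv κ k g t x'‖ ≤
      dilationConvConst κ A * (min 1 (quasiNorm κ (x - x') / t) * W) := by
  set q : ℝ := quasiNorm κ (x - x') / t
  set I : ℝ := growthConst κ * ∫ y, weight n y
  have hI : 0 ≤ I := mul_nonneg growthConst_nonneg (integral_nonneg weight_nonneg)
  have hA : 0 ≤ A := le_trans (by positivity) (hk 0)
  have hn : (1 : ℝ) ≤ n + 1 := by simp
  rcases le_total 1 q with hq | hq
  · have hbound := norm_dilationConv_le hκ ht.le hW hgc hg hkd.continuous hk hk0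
    calc ‖dilationConv κ k g t x - dilationConv κ k g t x'‖ ≤ A * I * W + A * I * W :=
          (norm_sub_le _ _).trans (add_le_add (hbound x) (hbound x'))
      _ = 2 * (A * 1) * I * W := by ring
      _ ≤ 2 * (A * (n + 1) ^ (n + 3)) * I * W := by gcongr; exact one_le_pow₀ hn
      _ = dilationConvConst κ A * (min 1 q * W) := by
          rw [min_eq_left hq, one_mul, dilationConvConst]
  · set η := dilation κ t⁻¹ (x - x')
    have hηq : quasiNorm κ η = q := by
      rw [quasiNorm_dilation hκ (inv_nonneg.2 ht.le), ← div_eq_inv_mul]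
    have hη : ‖η‖ ≤ n * q := hηq ▸ norm_le_of_quasiNorm_le_one hκ (hηq.le.trans hq)
    have hq0 : 0 ≤ q := hηq ▸ quasiNorm_nonneg η
    have hx : x = x' + dilation κ t η := by
      rw [dilation_dilation, mul_inv_cancel₀ ht.ne', dilation_one, add_sub_cancel]
    calc ‖dilationConv κ k g t x - dilationConv κ k g t x'‖
        ≤ A * (n + 1) ^ (n + 2) * ‖η‖ * I * W := by
          conv_lhs => rw [hx]
          exact norm_dilationConv_add_dilation_sub_le hκ ht.le hW hgc hg hkd hk hk'
            (hη.trans (mul_le_of_le_one_right n.cast_nonneg hq)) x'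
      _ ≤ A * (n + 1) ^ (n + 2) * (2 * ((n + 1) * q)) * I * W := by
          gcongr
          nlinarith [mul_nonneg n.cast_nonneg hq0]
      _ = dilationConvConst κ A * (min 1 q * W) := by
          rw [min_eq_right hq, dilationConvConst]; ring

end dilationConv

section dyadicSum

variable {n : ℕ} {κ : Fin n → ℕ}

lemma min_one_div_le {q s : ℝ} (hq : 0 ≤ q) (hs : 0 ≤ s) :
    min 1 (q / s) ≤ (1 + q) * min 1 (1 / s) := by
  rw [mul_min_of_nonneg _ _ (by positivity), mul_one, mul_one_div]
  gcongr <;> linarith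

/-- A family of functions `h j` on `ℝⁿ`, one for each dyadic scale `2^j`, whose increments are at
most `w j` and decay linearly in the quasi-norm below that scale. The weights `w` are summable
enough for the series of increments to converge. -/
structure IsDyadicFamily (κ : Fin n → ℕ) (h : ℤ → EuclideanSpace ℝ (Fin n) → ℂ) (w : ℤ → ℝ) :
    Prop where
  weight_nonneg : ∀ j, 0 ≤ w j
  summable : Summable fun j : ℤ => min 1 (1 / (2 : ℝ) ^ j) * w j
  norm_sub_le : ∀ j x y, ‖h j x - h j y‖ ≤ min 1 (quasiNorm κ (x - y) / 2 ^ j) * w j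

/-- The sum of a dyadic family, made convergent by subtracting from each member its value at the
origin. -/
def renormalizedSum (h : ℤ → EuclideanSpace ℝ (Fin n) → ℂ) (x : EuclideanSpace ℝ (Fin n)) : ℂ :=
  ∑' j, (h j x - h j 0)

namespace IsDyadicFamily

variable {h : ℤ → EuclideanSpace ℝ (Fin n) → ℂ} {w : ℤ → ℝ}

lemma norm_sub_le_mul (H : IsDyadicFamily κ h w) (j : ℤ) (x y : EuclideanSpace ℝ (Fin n)) :
    ‖h j x - h j y‖ ≤ (1 + quasiNorm κ (x - y)) * (min 1 (1 / (2 : ℝ) ^ j) * w j) := by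
  rw [← mul_assoc]
  exact (H.norm_sub_le j x y).trans (mul_le_mul_of_nonneg_right
    (min_one_div_le (quasiNorm_nonneg _) (by positivity)) (H.weight_nonneg j))

lemma summable_norm_sub (H : IsDyadicFamily κ h w) (x y : EuclideanSpace ℝ (Fin n)) :
    Summable fun j => ‖h j x - h j y‖ :=
  .of_nonneg_of_le (fun _ => norm_nonneg _) (fun j => H.norm_sub_le_mul j x y)
    (H.summable.mul_left _)

lemma tendsto_sub (hκ : ∀ l, 0 < κ l) (H : IsDyadicFamily κ h w) (j : ℤ)
    (x₀ : EuclideanSpace ℝ (Fin n)) : Tendsto (fun x => h j x - h j x₀) (𝓝 x₀) (𝓝 0) := by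
  refine squeeze_zero_norm (a := fun x => quasiNorm κ (x - x₀) / 2 ^ j * w j)
    (fun x => (H.norm_sub_le j x x₀).trans ?_) ?_
  · exact mul_le_mul_of_nonneg_right (min_le_right _ _) (H.weight_nonneg j)
  · simpa using ((tendsto_quasiNorm_sub hκ x₀).div_const _).mul_const _

lemma continuous (hκ : ∀ l, 0 < κ l) (H : IsDyadicFamily κ h w) (j : ℤ) : Continuous (h j) :=
  continuous_iff_continuousAt.2 fun x₀ => tendsto_sub_nhds_zero_iff.1 (H.tendsto_sub hκ j x₀)

lemma renormalizedSum_sub (H : IsDyadicFamily κ h w) (x y : EuclideanSpace ℝ (Fin n)) :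
    renormalizedSum h x - renormalizedSum h y = ∑' j, (h j x - h j y) := by
  rw [renormalizedSum, renormalizedSum,
    ← (H.summable_norm_sub x 0).of_norm.tsum_sub (H.summable_norm_sub y 0).of_norm]
  simp only [sub_sub_sub_cancel_right]

lemma continuous_renormalizedSum (hκ : ∀ l, 0 < κ l) (H : IsDyadicFamily κ h w) :
    Continuous (renormalizedSum h) := by
  refine continuous_iff_continuousAt.2 fun x₀ => tendsto_sub_nhds_zero_iff.1 ?_
  simp only [H.renormalizedSum_sub]
  rw [← tsum_zero (α := ℂ) (β := ℤ)]
  refine tendsto_tsum_of_dominated_convergence (H.summable.mul_left (1 + 1))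
    (fun j => H.tendsto_sub hκ j x₀) ?_
  filter_upwards [(tendsto_quasiNorm_sub hκ x₀).eventually_le_const zero_lt_one] with x hx j
  refine (H.norm_sub_le_mul j x x₀).trans ?_
  have := H.weight_nonneg j
  gcongr

lemma polynomialGrowth_renormalizedSum (hκ : ∀ l, 0 < κ l) (H : IsDyadicFamily κ h w) :
    PolynomialGrowth (renormalizedSum h) := by
  refine ⟨(n + 1) * ∑' j : ℤ, min 1 (1 / (2 : ℝ) ^ j) * w j, 1, fun x => ?_⟩
  have hw : 0 ≤ ∑' j : ℤ, min 1 (1 / (2 : ℝ) ^ j) * w j :=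
    tsum_nonneg fun j => mul_nonneg (by positivity) (H.weight_nonneg j)
  calc ‖renormalizedSum h x‖ ≤ ∑' j, ‖h j x - h j 0‖ :=
        norm_tsum_le_tsum_norm (H.summable_norm_sub x 0)
    _ ≤ ∑' j : ℤ, (1 + quasiNorm κ (x - 0)) * (min 1 (1 / (2 : ℝ) ^ j) * w j) :=
        (H.summable_norm_sub x 0).tsum_le_tsum (fun j => H.norm_sub_le_mul j x 0)
          (H.summable.mul_left _)
    _ = (1 + quasiNorm κ x) * ∑' j : ℤ, min 1 (1 / (2 : ℝ) ^ j) * w j := by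
        rw [tsum_mul_left, sub_zero]
    _ ≤ (n + 1) * (1 + ‖x‖) * ∑' j : ℤ, min 1 (1 / (2 : ℝ) ^ j) * w j := by
        gcongr
        exact one_add_quasiNorm_le hκ x
    _ = _ := by ring

lemma hasSum_integral (hκ : ∀ l, 0 < κ l) (H : IsDyadicFamily κ h w)
    (φ : 𝓢(EuclideanSpace ℝ (Fin n), ℂ)) :
    HasSum (fun j => ∫ x, φ x * (h j x - h j 0)) (∫ x, φ x * renormalizedSum h x) := by
  refine hasSum_integral_of_dominated_convergence
    (fun j x => ‖φ x‖ * (1 + quasiNorm κ x) * (min 1 (1 / (2 : ℝ) ^ j) * w j))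
    (fun j => ?_) (fun j => Eventually.of_forall fun x => ?_)
    (Eventually.of_forall fun x => H.summable.mul_left _) ?_
    (Eventually.of_forall fun x => (H.summable_norm_sub x 0).of_norm.hasSum.mul_left _)
  · exact (φ.continuous.mul ((H.continuous hκ j).sub continuous_const)).aestronglyMeasurable
  · rw [norm_mul, mul_assoc]
    gcongr
    simpa only [sub_zero] using H.norm_sub_le_mul j x 0
  · simp only [tsum_mul_left]
    refine Integrable.mul_const ?_ _
    have hq := continuous_quasiNorm (κ := κ)
    refine ((integrable_norm_mul_one_add_pow φ 1).const_mul (n + 1)).mono' (by fun_prop)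
      (Eventually.of_forall fun x => ?_)
    rw [Real.norm_of_nonneg
      (mul_nonneg (norm_nonneg _) (add_nonneg zero_le_one (quasiNorm_nonneg x))), pow_one,
      mul_left_comm]
    gcongr
    exact one_add_quasiNorm_le hκ x

lemma enorm_renormalizedSum_sub_le (hκ : ∀ l, 0 < κ l) {ω : ℝ → ℝ≥0∞} {P : ℝ} (hP : 0 ≤ P)
    (hω : Monotone ω) (hfin : diniBound ω 1 ≠ ∞)
    (H : IsDyadicFamily κ h fun j => P * (ω (2 ^ j)).toReal) (x y : EuclideanSpace ℝ (Fin n)) :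
    ‖renormalizedSum h x - renormalizedSum h y‖ₑ ≤
      ENNReal.ofReal (P * 4) * diniBound ω (quasiNorm κ (x - y)) := by
  rcases (quasiNorm_nonneg (κ := κ) (x - y)).eq_or_lt with hq | hq
  · simp [sub_eq_zero.1 ((quasiNorm_eq_zero_iff hκ).1 hq.symm)]
  rw [H.renormalizedSum_sub]
  calc ‖∑' j, (h j x - h j y)‖ₑ ≤ ∑' j, ‖h j x - h j y‖ₑ := enorm_tsum_le_tsum_enorm
    _ ≤ ∑' j : ℤ, ENNReal.ofReal P *
          (ENNReal.ofReal (min 1 (quasiNorm κ (x - y) / 2 ^ j)) * ω (2 ^ j)) := by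
        refine ENNReal.tsum_le_tsum fun j => ?_
        rw [← ofReal_norm]
        refine (ENNReal.ofReal_le_ofReal (H.norm_sub_le j x y)).trans_eq ?_
        rw [mul_left_comm, ENNReal.ofReal_mul hP, ENNReal.ofReal_mul (by positivity),
          ENNReal.ofReal_toReal (zpow_ne_top_of_diniBound_ne_top hω hfin j)]
    _ ≤ ENNReal.ofReal P * (4 * diniBound ω (quasiNorm κ (x - y))) := by
        rw [ENNReal.tsum_mul_left]
        gcongr
        exact tsum_dyadic_le_diniBound hω hq
    _ = _ := by
        rw [ENNReal.ofReal_mul hP, mul_assoc, ENNReal.ofReal_ofNat]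

end IsDyadicFamily

end dyadicSum

open scoped ContDiff

section seminorm

variable {E F : Type*} [NormedAddCommGroup E] [NormedSpace ℝ E] [NormedAddCommGroup F]
  [NormedSpace ℝ F]

lemma norm_iteratedFDeriv_comp_clm_le {G : Type*} [NormedAddCommGroup G] [NormedSpace ℝ G]
    {f : F → G} (hf : ContDiff ℝ ∞ f) (g : E →L[ℝ] F) (i : ℕ) (x : E) :
    ‖iteratedFDeriv ℝ i (fun y => f (g y)) x‖ ≤ ‖iteratedFDeriv ℝ i f (g x)‖ * ‖g‖ ^ i := by
  rw [show (fun y => f (g y)) = f ∘ g from rfl,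
    g.iteratedFDeriv_comp_right hf x (mod_cast le_top)]
  exact (ContinuousMultilinearMap.norm_compContinuousLinearMap_le _ _).trans_eq (by simp)

lemma norm_iteratedFDeriv_one_sub_le {f : E → ℂ} (hf : ContDiff ℝ ∞ f) {B : ℝ} {i : ℕ} {x : E}
    (hB : ‖iteratedFDeriv ℝ i f x‖ ≤ B) :
    ‖iteratedFDeriv ℝ i (fun y => 1 - f y) x‖ ≤ 1 + B := by
  rw [fun_iteratedFDeriv_sub_apply contDiffAt_const (hf.of_le (mod_cast le_top)).contDiffAt]
  refine (norm_sub_le _ _).trans (add_le_add ?_ hB)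
  rcases Nat.eq_zero_or_pos i with rfl | hi
  · simp
  · simp [iteratedFDeriv_const_of_ne hi.ne']

lemma norm_iteratedFDeriv_le_of_flat [NormedSpace ℂ F] [SMulCommClass ℝ ℂ F] (χ : 𝓢(E, F)) {L : ℕ}
    (h : ∀ i < L, iteratedFDeriv ℝ i χ 0 = 0) {i : ℕ} (hi : i ≤ L) (x : E) :
    ‖iteratedFDeriv ℝ i χ x‖ ≤ SchwartzMap.seminorm ℂ 0 L χ * ‖x‖ ^ (L - i) := by
  induction hi using Nat.decreasingInduction generalizing x with
  | self => simpa using SchwartzMap.norm_iteratedFDeriv_le_seminorm ℂ χ L x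
  | of_succ i hi ih =>
    have hderiv : ∀ y ∈ Metric.closedBall (0 : E) ‖x‖, ‖fderiv ℝ (iteratedFDeriv ℝ i χ) y‖
        ≤ SchwartzMap.seminorm ℂ 0 L χ * ‖x‖ ^ (L - (i + 1)) := fun y hy => by
      rw [norm_fderiv_iteratedFDeriv]
      refine (ih y).trans ?_
      gcongr
      simpa using hy
    have hmvt := (convex_closedBall (0 : E) ‖x‖).norm_image_sub_le_of_norm_fderiv_le
      (fun y _ => ((χ.smooth ⊤).differentiable_iteratedFDeriv
        (mod_cast ENat.natCast_lt_top i)) y) hderiv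
      (Metric.mem_closedBall_self (norm_nonneg x)) (by simp : x ∈ Metric.closedBall (0 : E) ‖x‖)
    rw [h i hi, sub_zero, sub_zero, mul_assoc, ← pow_succ] at hmvt
    rwa [show L - i = L - (i + 1) + 1 by lia]

lemma seminorm_smulLeftCLM_le [NormedSpace ℂ F] {h : E → ℂ}
    (hh : h.HasTemperateGrowth) (χ : 𝓢(E, F)) {k l : ℕ} {A δ : ℝ} (hA₀ : 0 ≤ A) (hδ₀ : 0 ≤ δ)
    (hA : ∀ i ≤ l, ∀ x, ‖iteratedFDeriv ℝ i h x‖ ≤ A)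
    (hδ : ∀ i ≤ l, ∀ x ∈ tsupport h, ‖x‖ ^ k * ‖iteratedFDeriv ℝ i χ x‖ ≤ δ) :
    SchwartzMap.seminorm ℂ k l (SchwartzMap.smulLeftCLM F h χ) ≤ 2 ^ l * (A * δ) := by
  refine SchwartzMap.seminorm_le_bound ℂ k l _ (by positivity) fun x => ?_
  rw [SchwartzMap.smulLeftCLM_apply hh]
  have hterm : ∀ i ≤ l,
      ‖iteratedFDeriv ℝ i h x‖ * (‖x‖ ^ k * ‖iteratedFDeriv ℝ (l - i) χ x‖) ≤ A * δ := by
    intro i hi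
    by_cases hx : x ∈ tsupport h
    · exact mul_le_mul (hA i hi x) (hδ _ (Nat.sub_le _ _) x hx) (by positivity) hA₀
    · rw [Function.notMem_support.1 fun hx' => hx (support_iteratedFDeriv_subset i hx'), norm_zero,
        zero_mul]
      positivity
  calc _ ≤ ‖x‖ ^ k * ∑ i ∈ Finset.range (l + 1), (l.choose i : ℝ) *
          ‖iteratedFDeriv ℝ i h x‖ * ‖iteratedFDeriv ℝ (l - i) χ x‖ := by
        gcongr
        exact norm_iteratedFDeriv_smul_le hh.1 (χ.smooth ⊤) x (mod_cast le_top)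
    _ = ∑ i ∈ Finset.range (l + 1), (l.choose i : ℝ) *
          (‖iteratedFDeriv ℝ i h x‖ * (‖x‖ ^ k * ‖iteratedFDeriv ℝ (l - i) χ x‖)) := by
        rw [Finset.mul_sum]
        exact Finset.sum_congr rfl fun i _ => by ring
    _ ≤ ∑ i ∈ Finset.range (l + 1), (l.choose i : ℝ) * (A * δ) :=
        Finset.sum_le_sum fun i hi => mul_le_mul_of_nonneg_left
          (hterm i (Finset.mem_range_succ_iff.1 hi)) (Nat.cast_nonneg _)
    _ = 2 ^ l * (A * δ) := by
        rw [← Finset.sum_mul, ← Nat.cast_sum, Nat.sum_range_choose]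
        norm_num

end seminorm

/-- A smooth cutoff function, equal to one on the unit ball and supported in the ball of
radius two. -/
def cutoff (n : ℕ) (x : EuclideanSpace ℝ (Fin n)) : ℂ :=
  ((⟨1, 2, one_pos, one_lt_two⟩ : ContDiffBump (0 : EuclideanSpace ℝ (Fin n))) x : ℝ)

section cutoff

variable {n : ℕ} {κ : Fin n → ℕ}

lemma cutoff_of_norm_le {x : EuclideanSpace ℝ (Fin n)} (h : ‖x‖ ≤ 1) : cutoff n x = 1 := by
  rw [cutoff, ContDiffBump.one_of_mem_closedBall _ (by simpa using h), Complex.ofReal_one]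

lemma cutoff_of_le_norm {x : EuclideanSpace ℝ (Fin n)} (h : 2 ≤ ‖x‖) : cutoff n x = 0 := by
  rw [cutoff, ContDiffBump.zero_of_le_dist _ (by simpa using h), Complex.ofReal_zero]

lemma contDiff_cutoff : ContDiff ℝ ∞ (cutoff n) :=
  Complex.ofRealCLM.contDiff.comp (ContDiffBump.contDiff _)

lemma hasCompactSupport_cutoff : HasCompactSupport (cutoff n) :=
  .intro (isCompact_closedBall 0 2) fun x hx =>
    cutoff_of_le_norm (not_le.1 (by simpa using hx)).le

lemma exists_norm_iteratedFDeriv_cutoff_le (n l : ℕ) :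
    ∃ B : ℝ, 0 ≤ B ∧ ∀ i ≤ l, ∀ x, ‖iteratedFDeriv ℝ i (cutoff n) x‖ ≤ B := by
  let S : 𝓢(EuclideanSpace ℝ (Fin n), ℂ) := hasCompactSupport_cutoff.toSchwartzMap contDiff_cutoff
  refine ⟨∑ i ∈ Finset.range (l + 1), SchwartzMap.seminorm ℝ 0 i S,
    Finset.sum_nonneg fun _ _ => apply_nonneg _ _, fun i hi x => ?_⟩
  exact (SchwartzMap.norm_iteratedFDeriv_le_seminorm ℝ S i x).trans
    (Finset.single_le_sum (f := fun i => SchwartzMap.seminorm ℝ 0 i S)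
      (fun _ _ => apply_nonneg _ _) (Finset.mem_range_succ_iff.2 hi))

/-- The dilated cutoff `φ(δ_t ξ)`, which restricts to the frequencies `|ξ|_κ ≲ 1 / t`. -/
def lowPass (κ : Fin n → ℕ) (t : ℝ) (ξ : EuclideanSpace ℝ (Fin n)) : ℂ :=
  cutoff n (dilation κ t ξ)

lemma lowPass_dilation (s t : ℝ) (ξ : EuclideanSpace ℝ (Fin n)) :
    lowPass κ s (dilation κ t ξ) = lowPass κ (s * t) ξ := by
  rw [lowPass, dilation_dilation, lowPass]

lemma contDiff_lowPass (t : ℝ) : ContDiff ℝ ∞ (lowPass κ t) :=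
  contDiff_cutoff.comp (dilation κ t).contDiff

lemma hasTemperateGrowth_lowPass (t : ℝ) : (lowPass κ t).HasTemperateGrowth :=
  (hasCompactSupport_cutoff.hasTemperateGrowth contDiff_cutoff).comp
    (dilation κ t).hasTemperateGrowth

lemma hasTemperateGrowth_one_sub_lowPass (t : ℝ) :
    (fun ξ => 1 - lowPass κ t ξ).HasTemperateGrowth := by
  have := hasTemperateGrowth_lowPass (κ := κ) t
  fun_prop

lemma norm_le_of_mem_tsupport_lowPass (hκ : ∀ l, 0 < κ l) {t : ℝ} (ht : 1 ≤ t)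
    {ξ : EuclideanSpace ℝ (Fin n)} (hξ : ξ ∈ tsupport (lowPass κ t)) : ‖ξ‖ ≤ 2 / t := by
  refine closure_minimal (t := {ξ | ‖ξ‖ ≤ 2 / t}) (fun η hη => ?_)
    (isClosed_le continuous_norm continuous_const) hξ
  rw [mem_ofPred_eq, le_div_iff₀' (by positivity)]
  exact (mul_norm_le_norm_dilation hκ ht η).trans
    (not_le.1 fun h => hη (cutoff_of_le_norm h)).le

lemma inv_le_norm_of_mem_tsupport_one_sub_lowPass (hκ : ∀ l, 0 < κ l) {t : ℝ} (ht₀ : 0 < t)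
    (ht₁ : t ≤ 1) {ξ : EuclideanSpace ℝ (Fin n)} (hξ : ξ ∈ tsupport fun ξ => 1 - lowPass κ t ξ) :
    t⁻¹ ≤ ‖ξ‖ := by
  refine closure_minimal (t := {ξ | t⁻¹ ≤ ‖ξ‖}) (fun η hη => ?_)
    (isClosed_le continuous_const continuous_norm) hξ
  rw [mem_ofPred_eq, inv_le_iff_one_le_mul₀' ht₀]
  exact (not_le.1 fun h => hη (by simp [lowPass, cutoff_of_norm_le h])).le.trans
    (norm_dilation_apply_le hκ ht₀.le ht₁ η)

lemma tendsto_seminorm_highPass (hκ : ∀ l, 0 < κ l) (χ : 𝓢(EuclideanSpace ℝ (Fin n), ℂ))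
    (k l : ℕ) :
    Tendsto (fun t : ℝ => SchwartzMap.seminorm ℂ k l
      (SchwartzMap.smulLeftCLM ℂ (fun ξ => 1 - lowPass κ t ξ) χ)) (𝓝[>] 0) (𝓝 0) := by
  obtain ⟨B, hB₀, hB⟩ := exists_norm_iteratedFDeriv_cutoff_le n l
  set D : ℝ := ∑ i ∈ Finset.range (l + 1), SchwartzMap.seminorm ℂ (k + 1) i χ
  have hD₀ : 0 ≤ D := Finset.sum_nonneg fun _ _ => apply_nonneg _ _
  have hbound : Tendsto (fun t : ℝ => 2 ^ l * ((1 + B) * (D * t))) (𝓝[>] 0) (𝓝 0) :=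
    ((by fun_prop : Continuous fun t : ℝ => 2 ^ l * ((1 + B) * (D * t))).tendsto' 0 0
      (by simp)).mono_left nhdsWithin_le_nhds
  refine squeeze_zero' (Eventually.of_forall fun _ => apply_nonneg _ _) ?_ hbound
  filter_upwards [Ioc_mem_nhdsGT one_pos] with t ⟨ht₀, ht₁⟩
  refine seminorm_smulLeftCLM_le (hasTemperateGrowth_one_sub_lowPass t) χ (by positivity)
    (mul_nonneg hD₀ ht₀.le) (fun i hi ξ => norm_iteratedFDeriv_one_sub_le (contDiff_lowPass t) ?_)
    fun i hi ξ hξ => ?_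
  · refine (norm_iteratedFDeriv_comp_clm_le contDiff_cutoff _ _ _).trans ?_
    exact (mul_le_of_le_one_right (norm_nonneg _)
      (pow_le_one₀ (norm_nonneg _) (norm_dilation_le_one hκ ht₀.le ht₁))).trans (hB i hi _)
  · have hDi : ‖ξ‖ ^ (k + 1) * ‖iteratedFDeriv ℝ i χ ξ‖ ≤ D :=
      (SchwartzMap.le_seminorm ℂ (k + 1) i χ ξ).trans
        (Finset.single_le_sum (f := fun i => SchwartzMap.seminorm ℂ (k + 1) i χ)
          (fun _ _ => apply_nonneg _ _) (Finset.mem_range_succ_iff.2 hi))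
    have hone : 1 ≤ t * ‖ξ‖ := (inv_le_iff_one_le_mul₀' ht₀).1
      (inv_le_norm_of_mem_tsupport_one_sub_lowPass hκ ht₀ ht₁ hξ)
    calc _ ≤ ‖ξ‖ ^ k * ‖iteratedFDeriv ℝ i χ ξ‖ * (t * ‖ξ‖) :=
          le_mul_of_one_le_right (by positivity) hone
      _ = ‖ξ‖ ^ (k + 1) * ‖iteratedFDeriv ℝ i χ ξ‖ * t := by ring
      _ ≤ D * t := by gcongr

lemma seminorm_lowPass_le (hκ : ∀ l, 0 < κ l) (χ : 𝓢(EuclideanSpace ℝ (Fin n), ℂ)) {k l L : ℕ}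
    (hL : (∑ j, κ j) * l + 1 + l ≤ L) (hχ : ∀ i < L, iteratedFDeriv ℝ i χ 0 = 0) {B : ℝ}
    (hB₀ : 0 ≤ B) (hB : ∀ i ≤ l, ∀ x, ‖iteratedFDeriv ℝ i (cutoff n) x‖ ≤ B) {t : ℝ}
    (ht : 2 ≤ t) :
    SchwartzMap.seminorm ℂ k l (SchwartzMap.smulLeftCLM ℂ (lowPass κ t) χ) ≤
      2 ^ l * (B * t ^ ((∑ j, κ j) * l) *
        (SchwartzMap.seminorm ℂ 0 L χ * (2 / t) ^ ((∑ j, κ j) * l + 1))) := by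
  have ht₁ : 1 ≤ t := by linarith
  have ht₂ : 2 / t ≤ 1 := (div_le_one (by positivity)).2 ht
  refine seminorm_smulLeftCLM_le (hasTemperateGrowth_lowPass t) χ (by positivity)
    (by positivity) (fun i hi ξ => ?_) fun i hi ξ hξ => ?_
  · refine (norm_iteratedFDeriv_comp_clm_le contDiff_cutoff _ _ _).trans ?_
    gcongr
    · exact hB i hi _
    · calc ‖dilation κ t‖ ^ i ≤ (t ^ ∑ j, κ j) ^ i := by
            gcongr
            exact norm_dilation_le_pow ht₁
        _ ≤ t ^ ((∑ j, κ j) * l) := by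
            rw [← pow_mul]
            gcongr
  · have hξ' : ‖ξ‖ ≤ 2 / t := norm_le_of_mem_tsupport_lowPass hκ ht₁ hξ
    calc ‖ξ‖ ^ k * ‖iteratedFDeriv ℝ i χ ξ‖
        ≤ 1 * (SchwartzMap.seminorm ℂ 0 L χ * ‖ξ‖ ^ (L - i)) := by
          gcongr
          · exact pow_le_one₀ (norm_nonneg _) (hξ'.trans ht₂)
          · exact norm_iteratedFDeriv_le_of_flat χ hχ (by lia) ξ
      _ ≤ SchwartzMap.seminorm ℂ 0 L χ * (2 / t) ^ ((∑ j, κ j) * l + 1) := by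
          rw [one_mul]
          gcongr ?_ * ?_
          calc ‖ξ‖ ^ (L - i) ≤ (2 / t) ^ (L - i) := by gcongr
            _ ≤ _ := pow_le_pow_of_le_one (by positivity) ht₂ (by lia)

lemma tendsto_seminorm_lowPass (hκ : ∀ l, 0 < κ l) (χ : 𝓢(EuclideanSpace ℝ (Fin n), ℂ))
    {k l L : ℕ} (hL : (∑ j, κ j) * l + 1 + l ≤ L) (hχ : ∀ i < L, iteratedFDeriv ℝ i χ 0 = 0) :
    Tendsto (fun t : ℝ => SchwartzMap.seminorm ℂ k l
      (SchwartzMap.smulLeftCLM ℂ (lowPass κ t) χ)) atTop (𝓝 0) := by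
  obtain ⟨B, hB₀, hB⟩ := exists_norm_iteratedFDeriv_cutoff_le n l
  have hbound := (tendsto_inv_atTop_zero (𝕜 := ℝ)).const_mul
    (2 ^ l * (B * SchwartzMap.seminorm ℂ 0 L χ * 2 ^ ((∑ j, κ j) * l + 1)))
  rw [mul_zero] at hbound
  refine squeeze_zero' (Eventually.of_forall fun _ => apply_nonneg _ _) ?_ hbound
  filter_upwards [eventually_ge_atTop 2] with t ht
  have ht₀ : t ≠ 0 := by positivity
  refine (seminorm_lowPass_le hκ χ hL hχ hB₀ hB ht).trans_eq ?_
  rw [div_pow, pow_succ t]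
  field_simp

/-- The restriction `φ(δ_{2^{-J}} ξ) - φ(δ_{2^J} ξ)` to the frequencies
`2^{-J} ≲ |ξ|_κ ≲ 2^J`. -/
def bandPass (κ : Fin n → ℕ) (J : ℕ) (ξ : EuclideanSpace ℝ (Fin n)) : ℂ :=
  lowPass κ (2 ^ (-J : ℤ)) ξ - lowPass κ (2 ^ (J : ℤ)) ξ

lemma hasTemperateGrowth_bandPass (J : ℕ) : (bandPass κ J).HasTemperateGrowth :=
  (hasTemperateGrowth_lowPass _).sub (hasTemperateGrowth_lowPass _)

lemma sub_smulLeftCLM_bandPass (J : ℕ) (χ : 𝓢(EuclideanSpace ℝ (Fin n), ℂ)) :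
    χ - SchwartzMap.smulLeftCLM ℂ (bandPass κ J) χ =
      SchwartzMap.smulLeftCLM ℂ (fun ξ => 1 - lowPass κ (2 ^ (-J : ℤ)) ξ) χ +
        SchwartzMap.smulLeftCLM ℂ (lowPass κ (2 ^ (J : ℤ))) χ := by
  ext ξ
  rw [sub_apply, add_apply, SchwartzMap.smulLeftCLM_apply_apply (hasTemperateGrowth_bandPass J),
    SchwartzMap.smulLeftCLM_apply_apply (hasTemperateGrowth_one_sub_lowPass _),
    SchwartzMap.smulLeftCLM_apply_apply (hasTemperateGrowth_lowPass _)]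
  simp only [bandPass, smul_eq_mul]
  ring

lemma tendsto_seminorm_sub_bandPass (hκ : ∀ l, 0 < κ l) (χ : 𝓢(EuclideanSpace ℝ (Fin n), ℂ))
    {k l L : ℕ} (hL : (∑ j, κ j) * l + 1 + l ≤ L) (hχ : ∀ i < L, iteratedFDeriv ℝ i χ 0 = 0) :
    Tendsto (fun J : ℕ => SchwartzMap.seminorm ℂ k l
      (χ - SchwartzMap.smulLeftCLM ℂ (bandPass κ J) χ)) atTop (𝓝 0) := by
  have hpow : Tendsto (fun J : ℕ => (2 : ℝ) ^ J) atTop atTop :=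
    tendsto_pow_atTop_atTop_of_one_lt one_lt_two
  have hhigh : Tendsto (fun J : ℕ => (2 : ℝ) ^ (-J : ℤ)) atTop (𝓝[>] 0) := by
    simpa only [zpow_neg, zpow_natCast, Function.comp_def] using
      tendsto_inv_atTop_nhdsGT_zero.comp hpow
  have hlow : Tendsto (fun J : ℕ => (2 : ℝ) ^ (J : ℤ)) atTop atTop :=
    mod_cast hpow
  have hsum := ((tendsto_seminorm_highPass hκ χ k l).comp hhigh).add
    ((tendsto_seminorm_lowPass hκ χ (k := k) hL hχ).comp hlow)
  rw [add_zero] at hsum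
  refine squeeze_zero (fun _ => apply_nonneg _ _) (fun J => ?_) hsum
  rw [sub_smulLeftCLM_bandPass]
  exact map_add_le_add _ _ _

lemma exists_order_tendsto_bandPass (hκ : ∀ l, 0 < κ l)
    (T : 𝓢(EuclideanSpace ℝ (Fin n), ℂ) →L[ℂ] ℂ) :
    ∃ L : ℕ, ∀ χ : 𝓢(EuclideanSpace ℝ (Fin n), ℂ), (∀ i < L, iteratedFDeriv ℝ i χ 0 = 0) →
      Tendsto (fun J : ℕ => T (SchwartzMap.smulLeftCLM ℂ (bandPass κ J) χ)) atTop (𝓝 (T χ)) := by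
  obtain ⟨s, C, -, hC⟩ := Seminorm.bound_of_continuous
    (schwartz_withSeminorms ℂ (EuclideanSpace ℝ (Fin n)) ℂ)
    ((normSeminorm ℂ ℂ).comp T.toLinearMap) (continuous_norm.comp T.continuous)
  refine ⟨s.sup fun p => (∑ j, κ j) * p.2 + 1 + p.2, fun χ hχ => ?_⟩
  have hlim : Tendsto (fun J : ℕ => C * ∑ p ∈ s, SchwartzMap.seminorm ℂ p.1 p.2
      (χ - SchwartzMap.smulLeftCLM ℂ (bandPass κ J) χ)) atTop (𝓝 0) := by
    simpa using (tendsto_finsetSum s fun p hp => tendsto_seminorm_sub_bandPass hκ χ (k := p.1)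
      (Finset.le_sup (f := fun p : ℕ × ℕ => (∑ j, κ j) * p.2 + 1 + p.2) hp) hχ).const_mul (C : ℝ)
  rw [tendsto_iff_norm_sub_tendsto_zero]
  refine squeeze_zero (fun _ => norm_nonneg _) (fun J => ?_) hlim
  rw [norm_sub_rev, ← map_sub]
  refine (hC _).trans ?_
  rw [smul_apply, NNReal.smul_def, smul_eq_mul]
  gcongr
  exact (Seminorm.finset_sup_le_sum (schwartzSeminormFamily ℂ _ _) s _).trans_eq (sum_apply _ _ _)

end cutoff

section polynomial

variable {n : ℕ}

lemma hasTemperateGrowth_coord (l : Fin n) :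
    (fun x : EuclideanSpace ℝ (Fin n) => (x l : ℂ)).HasTemperateGrowth :=
  Function.Complex.hasTemperateGrowth_ofReal.comp
    (EuclideanSpace.proj (𝕜 := ℝ) l : EuclideanSpace ℝ (Fin n) →L[ℝ] ℝ).hasTemperateGrowth

lemma hasTemperateGrowth_eval (Q : MvPolynomial (Fin n) ℂ) :
    (fun x : EuclideanSpace ℝ (Fin n) =>
      MvPolynomial.eval (fun l => (x l : ℂ)) Q).HasTemperateGrowth := by
  induction Q using MvPolynomial.induction_on with
  | C a =>
    simp only [MvPolynomial.eval_C]
    fun_prop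
  | add p q hp hq =>
    simp only [map_add]
    exact hp.add hq
  | mul_X p l hp =>
    simp only [map_mul, MvPolynomial.eval_X]
    exact hp.mul (hasTemperateGrowth_coord l)

lemma integrable_mul_eval (φ : 𝓢(EuclideanSpace ℝ (Fin n), ℂ)) (Q : MvPolynomial (Fin n) ℂ) :
    Integrable fun x => φ x * MvPolynomial.eval (fun l => (x l : ℂ)) Q := by
  refine (SchwartzMap.smulLeftCLM ℂ (fun x : EuclideanSpace ℝ (Fin n) =>
    MvPolynomial.eval (fun l => (x l : ℂ)) Q) φ).integrable.congr
    (Eventually.of_forall fun x => ?_)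
  rw [SchwartzMap.smulLeftCLM_apply_apply (hasTemperateGrowth_eval Q), smul_eq_mul, mul_comm]

lemma lineDerivOp_single_fourierInv (φ : 𝓢(EuclideanSpace ℝ (Fin n), ℂ)) (l : Fin n) :
    ∂_{EuclideanSpace.single l (1 : ℝ)} (𝓕⁻ φ) =
      𝓕⁻ (SchwartzMap.smulLeftCLM ℂ
        (fun x => 2 * Real.pi * Complex.I * (x l : ℂ)) φ) := by
  have hcoord := hasTemperateGrowth_coord l
  rw [SchwartzMap.lineDerivOp_fourierInv_eq]
  congr 1
  ext x
  rw [smul_apply, SchwartzMap.smulLeftCLM_apply_apply (by fun_prop),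
    SchwartzMap.smulLeftCLM_apply_apply (by fun_prop)]
  simp [EuclideanSpace.inner_single_right, mul_assoc]

lemma exists_iteratedLineDerivOp_fourierInv (i : ℕ) (s : Fin i → Fin n) :
    ∃ Q : MvPolynomial (Fin n) ℂ, ∀ φ : 𝓢(EuclideanSpace ℝ (Fin n), ℂ),
      ∂^{fun j => EuclideanSpace.single (s j) (1 : ℝ)} (𝓕⁻ φ) =
        𝓕⁻ (SchwartzMap.smulLeftCLM ℂ (fun x => MvPolynomial.eval (fun l => (x l : ℂ)) Q) φ) := by
  induction i with
  | zero => exact ⟨1, fun φ => by simp⟩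
  | succ i ih =>
    obtain ⟨Q, hQ⟩ := ih (Fin.tail s)
    refine ⟨MvPolynomial.C (2 * Real.pi * Complex.I) * MvPolynomial.X (s 0) * Q, fun φ => ?_⟩
    have hcoord := hasTemperateGrowth_coord (s 0)
    rw [LineDeriv.iteratedLineDerivOp_succ_left]
    change ∂_{EuclideanSpace.single (s 0) (1 : ℝ)}
      (∂^{fun j => EuclideanSpace.single (Fin.tail s j) (1 : ℝ)} (𝓕⁻ φ)) = _
    rw [hQ, lineDerivOp_single_fourierInv,
      SchwartzMap.smulLeftCLM_smulLeftCLM_apply (by fun_prop) (hasTemperateGrowth_eval Q)]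
    simp only [map_mul, MvPolynomial.eval_C, MvPolynomial.eval_X]
    rfl

lemma fourierInv_apply_zero (φ : 𝓢(EuclideanSpace ℝ (Fin n), ℂ)) : (𝓕⁻ φ) 0 = ∫ x, φ x := by
  simp [SchwartzMap.fourierInv_coe, Real.fourierInv_eq]

/-- The Fourier transform of a polynomial `Q`, as a functional on Schwartz functions. -/
def polynomialFourier (n : ℕ) :
    MvPolynomial (Fin n) ℂ →ₗ[ℂ] 𝓢(EuclideanSpace ℝ (Fin n), ℂ) →ₗ[ℂ] ℂ :=
  LinearMap.mk₂ ℂ (fun Q χ => ∫ x, (𝓕 χ) x * MvPolynomial.eval (fun l => (x l : ℂ)) Q)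
    (fun Q₁ Q₂ χ => by
      simp only [map_add, mul_add]
      exact integral_add (integrable_mul_eval _ _) (integrable_mul_eval _ _))
    (fun c Q χ => by
      simp only [MvPolynomial.smul_eval, mul_left_comm _ c, integral_const_mul, smul_eq_mul])
    (fun Q χ₁ χ₂ => by
      simp only [FourierTransform.fourier_add, add_apply, add_mul]
      exact integral_add (integrable_mul_eval _ _) (integrable_mul_eval _ _))
    (fun c Q χ => by
      simp only [FourierTransform.fourier_smul, smul_apply, smul_eq_mul, mul_assoc,
        integral_const_mul])

/-- The functional `χ ↦ ∂_{s 0} ⋯ ∂_{s (i - 1)} χ (0)` on Schwartz functions. -/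
def partialDerivAtZero {i : ℕ} (s : Fin i → Fin n) :
    𝓢(EuclideanSpace ℝ (Fin n), ℂ) →ₗ[ℂ] ℂ where
  toFun χ := (∂^{fun j => EuclideanSpace.single (s j) (1 : ℝ)} χ) 0
  map_add' χ₁ χ₂ := by rw [LineDeriv.iteratedLineDerivOp_add, add_apply]
  map_smul' c χ := by rw [LineDeriv.iteratedLineDerivOp_smul, smul_apply, RingHom.id_apply]

lemma partialDerivAtZero_mem_range_polynomialFourier {i : ℕ} (s : Fin i → Fin n) :
    partialDerivAtZero s ∈ LinearMap.range (polynomialFourier n) := by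
  obtain ⟨Q, hQ⟩ := exists_iteratedLineDerivOp_fourierInv i s
  refine ⟨Q, LinearMap.ext fun χ => ?_⟩
  have hχ := congr($(hQ (𝓕 χ)) 0)
  rw [FourierTransform.fourierInv_fourier_eq, fourierInv_apply_zero] at hχ
  refine Eq.trans ?_ hχ.symm
  refine integral_congr_ae (Eventually.of_forall fun x => ?_)
  simp only [SchwartzMap.smulLeftCLM_apply_apply (hasTemperateGrowth_eval Q), smul_eq_mul, mul_comm]

lemma iteratedFDeriv_eq_zero_of_partialDerivAtZero {i : ℕ} {χ : 𝓢(EuclideanSpace ℝ (Fin n), ℂ)}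
    (h : ∀ s : Fin i → Fin n, partialDerivAtZero s χ = 0) : iteratedFDeriv ℝ i χ 0 = 0 := by
  refine ContinuousMultilinearMap.toMultilinearMap_injective
    (Module.Basis.ext_multilinear (fun _ => (EuclideanSpace.basisFun (Fin n) ℝ).toBasis)
      fun s => ?_)
  have hs : (∂^{fun j => EuclideanSpace.single (s j) (1 : ℝ)} χ) 0 = 0 := h s
  rw [SchwartzMap.iteratedLineDerivOp_eq_iteratedFDeriv] at hs
  simpa using hs

lemma exists_polynomial_of_flat (T : 𝓢(EuclideanSpace ℝ (Fin n), ℂ) →ₗ[ℂ] ℂ) (L : ℕ)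
    (h : ∀ χ : 𝓢(EuclideanSpace ℝ (Fin n), ℂ), (∀ i < L, iteratedFDeriv ℝ i χ 0 = 0) → T χ = 0) :
    ∃ Q : MvPolynomial (Fin n) ℂ, ∀ χ : 𝓢(EuclideanSpace ℝ (Fin n), ℂ),
      T χ = ∫ x, (𝓕 χ) x * MvPolynomial.eval (fun l => (x l : ℂ)) Q := by
  let δ : (Σ i : Fin L, (Fin i → Fin n)) → 𝓢(EuclideanSpace ℝ (Fin n), ℂ) →ₗ[ℂ] ℂ :=
    fun p => partialDerivAtZero p.2
  have hspan : T ∈ Submodule.span ℂ (range δ) := mem_span_of_iInf_ker_le_ker fun χ hχ =>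
    h χ fun i hi => iteratedFDeriv_eq_zero_of_partialDerivAtZero fun s =>
      (Submodule.mem_iInf _).1 hχ ⟨⟨i, hi⟩, s⟩
  have hle : Submodule.span ℂ (range δ) ≤ LinearMap.range (polynomialFourier n) :=
    Submodule.span_le.2 (range_subset_iff.2 fun p =>
      partialDerivAtZero_mem_range_polynomialFourier p.2)
  obtain ⟨Q, rfl⟩ := hle hspan
  exact ⟨Q, fun χ => rfl⟩

end polynomial

section symbol

variable {n : ℕ} {κ : Fin n → ℕ} {m : ℕ}

/-- The finite set of multi-indices of weighted order `m`, for positive weights `κ`. Since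
`γ l ≤ γ · κ`, it is enough to search the box `{0, …, m}^n`. -/
def weightedIndices (κ : Fin n → ℕ) (m : ℕ) : Finset (Fin n → ℕ) :=
  {γ ∈ Fintype.piFinset fun _ => Finset.range (m + 1) | weightedOrder κ γ = m}

lemma mem_weightedIndices (hκ : ∀ l, 0 < κ l) {γ : Fin n → ℕ} :
    γ ∈ weightedIndices κ m ↔ weightedOrder κ γ = m := by
  simp only [weightedIndices, Finset.mem_filter, Fintype.mem_piFinset, Finset.mem_range_succ_iff,
    and_iff_right_iff_imp]
  rintro rfl l
  exact (Nat.le_mul_of_pos_right _ (hκ l)).trans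
    (Finset.single_le_sum (f := fun l => γ l * κ l) (fun _ _ => Nat.zero_le _) (Finset.mem_univ l))

/-- The monomial `(iξ)^γ`. -/
def imagMonomial (γ : Fin n → ℕ) (ξ : EuclideanSpace ℝ (Fin n)) : ℂ :=
  ∏ l, (Complex.I * (ξ l : ℂ)) ^ γ l

lemma imagMonomial_add (γ γ' : Fin n → ℕ) (ξ : EuclideanSpace ℝ (Fin n)) :
    imagMonomial (γ + γ') ξ = imagMonomial γ ξ * imagMonomial γ' ξ := by
  simp [imagMonomial, pow_add, Finset.prod_mul_distrib]

lemma imagMonomial_dilation (γ : Fin n → ℕ) (t : ℝ) (ξ : EuclideanSpace ℝ (Fin n)) :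
    imagMonomial γ (dilation κ t ξ) = (t : ℂ) ^ weightedOrder κ γ * imagMonomial γ ξ := by
  rw [imagMonomial, imagMonomial, weightedOrder, ← Finset.prod_pow_eq_pow_sum,
    ← Finset.prod_mul_distrib]
  refine Finset.prod_congr rfl fun l _ => ?_
  rw [dilation_apply, mul_comm (γ l), pow_mul, ← mul_pow]
  push_cast
  ring

lemma contDiff_imagMonomial (γ : Fin n → ℕ) : ContDiff ℝ ∞ (imagMonomial γ) :=
  contDiff_prod fun l _ => (contDiff_const.mul (Complex.ofRealCLM.contDiff.comp
    (EuclideanSpace.proj (𝕜 := ℝ) l : EuclideanSpace ℝ (Fin n) →L[ℝ] ℝ).contDiff)).pow _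

/-- The `κ`-homogeneous symbol `∑ c_γ (iξ)^γ` of degree `m` with coefficients `c`. -/
def homSymbol (c : weightedIndices κ m → ℂ) (ξ : EuclideanSpace ℝ (Fin n)) : ℂ :=
  ∑ γ, c γ * imagMonomial γ ξ

lemma homSymbol_dilation (hκ : ∀ l, 0 < κ l) (c : weightedIndices κ m → ℂ) (t : ℝ)
    (ξ : EuclideanSpace ℝ (Fin n)) :
    homSymbol c (dilation κ t ξ) = (t : ℂ) ^ m * homSymbol c ξ := by
  simp only [homSymbol, Finset.mul_sum]
  refine Finset.sum_congr rfl fun γ _ => ?_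
  rw [imagMonomial_dilation, (mem_weightedIndices hκ).1 γ.2, mul_left_comm]

lemma contDiff_homSymbol_uncurry :
    ContDiff ℝ ∞ fun p : (weightedIndices κ m → ℂ) × EuclideanSpace ℝ (Fin n) =>
      homSymbol p.1 p.2 :=
  ContDiff.sum fun γ _ =>
    ((ContinuousLinearMap.proj (R := ℝ) (φ := fun _ : weightedIndices κ m => ℂ) γ).contDiff.comp
      contDiff_fst).mul ((contDiff_imagMonomial _).comp contDiff_snd)

lemma exists_homSymbol_eq_symbol (hκ : ∀ l, 0 < κ l) {𝒜 ℬ : Finset (Fin n → ℕ)}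
    (h : ∀ α ∈ 𝒜, ∀ β ∈ ℬ, weightedOrder κ (α + β) = m) (a : (Fin n → ℕ) → (Fin n → ℕ) → ℂ) :
    ∃ c : weightedIndices κ m → ℂ, homSymbol c = symbol 𝒜 ℬ a := by
  refine ⟨fun γ => ∑ α ∈ 𝒜, ∑ β ∈ ℬ, if α + β = γ then a α β else 0, ?_⟩
  ext ξ
  simp only [homSymbol, symbol, Finset.sum_mul]
  rw [Finset.sum_comm]
  refine Finset.sum_congr rfl fun α hα => ?_
  rw [Finset.sum_comm]
  refine Finset.sum_congr rfl fun β hβ => ?_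
  rw [Finset.sum_eq_single_of_mem ⟨α + β, (mem_weightedIndices hκ).2 (h α hα β hβ)⟩
    (Finset.mem_univ _) fun γ _ hγ => by
      rw [if_neg fun h => hγ (Subtype.ext h.symm), zero_mul]]
  simp [imagMonomial]

/-- The polynomial in `ξ` which computes `homSymbol c`. -/
def homPolynomial (c : weightedIndices κ m → ℂ) : MvPolynomial (Fin n) ℂ :=
  ∑ γ : weightedIndices κ m,
    MvPolynomial.monomial (Finsupp.equivFunOnFinite.symm γ.1) (c γ * ∏ l, Complex.I ^ γ.1 l)

lemma eval_homPolynomial (c : weightedIndices κ m → ℂ) (ξ : EuclideanSpace ℝ (Fin n)) :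
    MvPolynomial.eval (fun l => (ξ l : ℂ)) (homPolynomial c) = homSymbol c ξ := by
  rw [homPolynomial, homSymbol, map_sum]
  refine Finset.sum_congr rfl fun γ _ => ?_
  rw [MvPolynomial.eval_monomial, imagMonomial, Finsupp.prod_fintype _ _ (by simp), mul_assoc,
    ← Finset.prod_mul_distrib]
  simp only [Finsupp.equivFunOnFinite_symm_apply_apply, mul_pow]

lemma coeff_homPolynomial (c : weightedIndices κ m → ℂ) (γ : weightedIndices κ m) :
    (homPolynomial c).coeff (Finsupp.equivFunOnFinite.symm γ.1) =
      c γ * ∏ l, Complex.I ^ γ.1 l := by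
  rw [homPolynomial, MvPolynomial.coeff_sum, Finset.sum_eq_single_of_mem γ (Finset.mem_univ γ)]
  · rw [MvPolynomial.coeff_monomial, if_pos rfl]
  · intro γ' _ hne
    rw [MvPolynomial.coeff_monomial,
      if_neg fun h => hne (Subtype.ext (Finsupp.equivFunOnFinite.symm.injective h))]

/-- The cube `[0, 1]^n`, on which polynomials are determined by their values. -/
def unitCube (n : ℕ) : Set (EuclideanSpace ℝ (Fin n)) :=
  {ξ | ∀ l, ξ l ∈ Icc (0 : ℝ) 1}

lemma isCompact_unitCube : IsCompact (unitCube n) := by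
  have hcube : unitCube n =
      PiLp.homeomorph 2 (fun _ : Fin n => ℝ) ⁻¹' univ.pi fun _ => Icc 0 1 := by
    ext ξ
    simp [unitCube, PiLp.homeomorph, WithLp.equiv, Pi.le_def, forall_and]
  rw [hcube, Homeomorph.isCompact_preimage]
  exact isCompact_univ_pi fun _ => isCompact_Icc

lemma coeff_eq_zero_of_homSymbol_eq_zero {c : weightedIndices κ m → ℂ}
    (h : ∀ ξ ∈ unitCube n, homSymbol c ξ = 0) : c = 0 := by
  have hpoly : homPolynomial c = 0 := by
    refine MvPolynomial.funext_set (fun _ => Complex.ofReal '' Icc (0 : ℝ) 1)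
      (fun _ => (Icc_infinite zero_lt_one).image Complex.ofReal_injective.injOn) fun x hx => ?_
    choose y hy hyx using fun l => hx l (mem_univ l)
    obtain rfl : (fun l => (y l : ℂ)) = x := funext hyx
    exact ((eval_homPolynomial c (WithLp.toLp 2 y)).trans (h _ hy)).trans (map_zero _).symm
  funext γ
  have hcoeff := coeff_homPolynomial c γ
  rw [hpoly, MvPolynomial.coeff_zero, eq_comm, mul_eq_zero] at hcoeff
  exact hcoeff.resolve_right
    (Finset.prod_ne_zero_iff.2 fun l _ => pow_ne_zero _ Complex.I_ne_zero)

/-- The restriction of the symbol to the unit cube, as a linear function of the coefficients. -/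
def homSymbolOnCube (κ : Fin n → ℕ) (m : ℕ) :
    (weightedIndices κ m → ℂ) →ₗ[ℂ] C(unitCube n, ℂ) where
  toFun c := ⟨fun ξ => homSymbol c ξ, (contDiff_homSymbol_uncurry.continuous.comp
    (Continuous.prodMk_right c)).comp continuous_subtype_val⟩
  map_add' c c' := by ext ξ; simp [homSymbol, add_mul, Finset.sum_add_distrib]
  map_smul' a c := by ext ξ; simp [homSymbol, Finset.mul_sum, mul_assoc]

lemma exists_norm_coeff_le (κ : Fin n → ℕ) (m : ℕ) (Lam : ℝ) :
    ∃ R : ℝ, ∀ c : weightedIndices κ m → ℂ,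
      (∀ ξ, ‖homSymbol c ξ‖ ≤ Lam * quasiNorm κ ξ ^ m) → ‖c‖ ≤ R := by
  have : CompactSpace (unitCube n) := isCompact_iff_compactSpace.1 isCompact_unitCube
  have hker : LinearMap.ker (homSymbolOnCube κ m) = ⊥ :=
    LinearMap.ker_eq_bot'.2 fun c hc => coeff_eq_zero_of_homSymbol_eq_zero fun ξ hξ =>
      congr($hc ⟨ξ, hξ⟩)
  obtain ⟨A, -, hA⟩ := (homSymbolOnCube κ m).exists_antilipschitzWith hker
  obtain ⟨D, hD⟩ := isCompact_unitCube.exists_bound_of_continuousOn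
    (f := fun ξ => Lam * quasiNorm κ ξ ^ m)
    (continuous_const.mul (continuous_quasiNorm.pow m)).continuousOn
  refine ⟨A * |D|, fun c hc => (hA.le_mul_norm (map_zero _) c).trans ?_⟩
  gcongr
  refine (ContinuousMap.norm_le _ (abs_nonneg D)).2 fun ξ => (hc ξ).trans ?_
  exact (le_abs_self _).trans ((hD ξ ξ.2).trans (le_abs_self D))

end symbol

section smoothInv

/-- A smooth function on `ℂ` which agrees with `z⁻¹` for `r ≤ ‖z‖`. -/
def smoothInv {r : ℝ} (hr : 0 < r) (z : ℂ) : ℂ :=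
  (‖z‖ ^ 2 + (⟨r / 2, r, half_pos hr, half_lt_self hr⟩ : ContDiffBump (0 : ℂ)) z)⁻¹ •
    (starRingEnd ℂ) z

lemma smoothInv_of_le {r : ℝ} (hr : 0 < r) {z : ℂ} (hz : r ≤ ‖z‖) : smoothInv hr z = z⁻¹ := by
  rw [smoothInv, ContDiffBump.zero_of_le_dist _ (by simpa using hz), add_zero,
    Complex.inv_def, Complex.normSq_eq_norm_sq, Complex.real_smul, mul_comm]

lemma contDiff_smoothInv {r : ℝ} (hr : 0 < r) : ContDiff ℝ ∞ (smoothInv hr) := by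
  refine ContDiff.smul (ContDiff.inv ((contDiff_norm_sq ℝ).add (ContDiffBump.contDiff _)) ?_)
    Complex.conjCLE.contDiff
  intro z
  rcases eq_or_ne z 0 with rfl | hz
  · simp [ContDiffBump.one_of_mem_closedBall, (half_pos hr).le]
  · exact (add_pos_of_pos_of_nonneg (by positivity) (ContDiffBump.nonneg _)).ne'

end smoothInv

section uniform

variable {V E : Type*} [NormedAddCommGroup V] [NormedSpace ℝ V] [ProperSpace V]
  [NormedAddCommGroup E]

lemma exists_uniform_decay [NormedSpace ℝ E] [ProperSpace E] {H : V × E → ℂ}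
    (hH : ContDiff ℝ ∞ H) {ρ : ℝ} (hsupp : ∀ c ξ, ρ ≤ ‖ξ‖ → H (c, ξ) = 0) (R : ℝ) (k l : ℕ) :
    ∃ B : ℝ, ∀ c, ‖c‖ ≤ R → ∀ ξ, ‖ξ‖ ^ k * ‖iteratedFDeriv ℝ l (fun ξ => H (c, ξ)) ξ‖ ≤ B := by
  obtain ⟨D, hD⟩ := ((isCompact_closedBall (0 : V) R).prod
    (isCompact_closedBall (0 : E) ρ)).exists_bound_of_continuousOn
    (hH.continuous_iteratedFDeriv (m := l) (mod_cast le_top)).continuousOn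
  refine ⟨|ρ| ^ k * |D|, fun c hc ξ => ?_⟩
  by_cases hξ : ξ ∈ tsupport fun ξ => H (c, ξ)
  · have hξρ : ‖ξ‖ ≤ ρ := closure_minimal (t := {ξ | ‖ξ‖ ≤ ρ})
      (fun η (hη : H (c, η) ≠ 0) => (not_le.1 fun h => hη (hsupp c η h)).le)
      (isClosed_le continuous_norm continuous_const) hξ
    have hslice := norm_iteratedFDeriv_comp_clm_le
      (hH.comp ((contDiff_const (c := ((c, 0) : V × E))).add contDiff_id))
      (ContinuousLinearMap.inr ℝ V E) l ξ
    simp only [Function.comp_def, id, iteratedFDeriv_comp_add_left, ContinuousLinearMap.inr_apply,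
      Prod.mk_add_mk, add_zero, zero_add] at hslice
    gcongr
    · exact hξρ.trans (le_abs_self _)
    · refine hslice.trans ((mul_le_of_le_one_right (norm_nonneg _) (pow_le_one₀ (norm_nonneg _)
        (ContinuousLinearMap.norm_inr_le_one ℝ V E))).trans ?_)
      exact (hD (c, ξ) ⟨by simpa using hc, by simpa using hξρ⟩).trans (le_abs_self D)
  · rw [Function.notMem_support.1 fun hξ' => hξ (support_iteratedFDeriv_subset l hξ'), norm_zero,
      mul_zero]
    positivity

lemma exists_one_add_norm_pow_mul_le [NormedSpace ℝ E] {F : Type*} [NormedAddCommGroup F]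
    [NormedSpace ℝ F] [NormedSpace ℂ F] [SMulCommClass ℝ ℂ F] {S : Set 𝓢(E, F)}
    (hS : Bornology.IsVonNBounded ℂ S) (k l : ℕ) :
    ∃ B : ℝ, ∀ f ∈ S, ∀ x, (1 + ‖x‖) ^ k * ‖iteratedFDeriv ℝ l f x‖ ≤ B := by
  obtain ⟨B, -, hB⟩ := (schwartz_withSeminorms ℂ E F).isVonNBounded_iff_finset_seminorm_bounded.1
    hS (Finset.Iic (k, l))
  exact ⟨2 ^ k * B, fun f hf x =>
    (SchwartzMap.one_add_le_sup_seminorm_apply (𝕜 := ℂ) (m := (k, l)) le_rfl le_rfl f x).trans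
      (mul_le_mul_of_nonneg_left (hB f hf).le (by positivity))⟩

lemma exists_uniform_kernels [InnerProductSpace ℝ E] [FiniteDimensional ℝ E] [MeasurableSpace E]
    [BorelSpace E] {H : V × E → ℂ} (hH : ContDiff ℝ ∞ H) {ρ : ℝ}
    (hsupp : ∀ c ξ, ρ ≤ ‖ξ‖ → H (c, ξ) = 0) (R : ℝ) (N : ℕ) :
    ∃ B : ℝ, ∀ c, ‖c‖ ≤ R → ∃ k : 𝓢(E, ℂ), (∀ ξ, (𝓕 k) ξ = H (c, ξ)) ∧
      ∀ y, (1 + ‖y‖) ^ N * ‖k y‖ ≤ B ∧ (1 + ‖y‖) ^ N * ‖fderiv ℝ k y‖ ≤ B := by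
  have : ProperSpace E := FiniteDimensional.proper_real E
  have hcpt : ∀ c, HasCompactSupport fun ξ => H (c, ξ) := fun c =>
    .intro (isCompact_closedBall 0 ρ) fun ξ hξ => hsupp c ξ (not_le.1 (by simpa using hξ)).le
  let M : V → 𝓢(E, ℂ) := fun c =>
    (hcpt c).toSchwartzMap (hH.comp (contDiff_const.prodMk contDiff_id))
  have hM : Bornology.IsVonNBounded ℂ (M '' Metric.closedBall 0 R) := by
    refine ((schwartz_withSeminorms ℂ E ℂ).image_isVonNBounded_iff_seminorm_bounded M).2
      fun p => ?_
    obtain ⟨B, hB⟩ := exists_uniform_decay hH hsupp R p.1 p.2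
    refine ⟨|B| + 1, by positivity, fun c hc => lt_of_le_of_lt ?_ (lt_add_one _)⟩
    exact SchwartzMap.seminorm_le_bound ℂ p.1 p.2 _ (abs_nonneg B) fun ξ =>
      (hB c (by simpa using hc) ξ).trans (le_abs_self B)
  have hker := hM.image (FourierTransform.fourierInvCLM ℂ 𝓢(E, ℂ) : 𝓢(E, ℂ) →L[ℂ] 𝓢(E, ℂ))
  obtain ⟨B₀, hB₀⟩ := exists_one_add_norm_pow_mul_le hker N 0
  obtain ⟨B₁, hB₁⟩ := exists_one_add_norm_pow_mul_le hker N 1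
  refine ⟨max B₀ B₁, fun c hc => ⟨𝓕⁻ (M c), fun ξ => ?_, fun y => ?_⟩⟩
  · rw [FourierTransform.fourier_fourierInv_eq]
    rfl
  · have hmem := mem_image_of_mem (FourierTransform.fourierInvCLM ℂ 𝓢(E, ℂ) : 𝓢(E, ℂ) →L[ℂ] 𝓢(E, ℂ))
      (mem_image_of_mem M (mem_closedBall_zero_iff.2 hc))
    have h₀ := hB₀ _ hmem y
    have h₁ := hB₁ _ hmem y
    rw [norm_iteratedFDeriv_zero] at h₀
    rw [norm_iteratedFDeriv_one] at h₁
    exact ⟨h₀.trans (le_max_left _ _), h₁.trans (le_max_right _ _)⟩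

end uniform

section kernel

variable {n : ℕ} {κ : Fin n → ℕ} {m : ℕ}

/-- The multiplier of the anisotropic dyadic annulus `1 < |δ_2 ξ|`, `|ξ| < 2`; its dilates form a
partition of unity away from the origin. -/
def annulus (κ : Fin n → ℕ) (ξ : EuclideanSpace ℝ (Fin n)) : ℂ :=
  lowPass κ 1 ξ - lowPass κ 2 ξ

lemma annulus_zero : annulus κ 0 = 0 := by simp [annulus, lowPass]

lemma annulus_of_le_norm (hκ : ∀ l, 0 < κ l) {ξ : EuclideanSpace ℝ (Fin n)} (h : 2 ≤ ‖ξ‖) :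
    annulus κ ξ = 0 := by
  have hδ := mul_norm_le_norm_dilation hκ one_le_two ξ
  rw [annulus, lowPass, lowPass, dilation_one, cutoff_of_le_norm h,
    cutoff_of_le_norm (by linarith), sub_zero]

lemma one_lt_norm_dilation_of_annulus_ne_zero (hκ : ∀ l, 0 < κ l) {ξ : EuclideanSpace ℝ (Fin n)}
    (h : annulus κ ξ ≠ 0) : 1 < ‖dilation κ 2 ξ‖ := by
  by_contra! h1
  have hδ := mul_norm_le_norm_dilation hκ one_le_two ξ
  refine h ?_
  rw [annulus, lowPass, lowPass, dilation_one, cutoff_of_norm_le h1,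
    cutoff_of_norm_le (by linarith [norm_nonneg ξ]), sub_self]

lemma contDiff_annulus : ContDiff ℝ ∞ (annulus κ) :=
  (contDiff_lowPass 1).sub (contDiff_lowPass 2)

lemma sum_annulus_dilation (J : ℕ) (ξ : EuclideanSpace ℝ (Fin n)) :
    ∑ j ∈ Finset.Ico (-J : ℤ) J, annulus κ (dilation κ (2 ^ j) ξ) = bandPass κ J ξ := by
  rw [bandPass, ← Finset.sum_Ico_int_sub J fun j : ℤ => lowPass κ (2 ^ j) ξ]
  refine Finset.sum_congr rfl fun j _ => ?_
  rw [annulus, lowPass_dilation, lowPass_dilation, one_mul, zpow_add_one₀ two_ne_zero, mul_comm]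

lemma quasiNorm_le_quasiNorm_smul {s : ℝ} (hs : 1 ≤ s) (ξ : EuclideanSpace ℝ (Fin n)) :
    quasiNorm κ ξ ≤ quasiNorm κ (s • ξ) := by
  refine Real.sqrt_le_sqrt (Finset.sum_le_sum fun l _ => ?_)
  refine Real.rpow_le_rpow (abs_nonneg _) ?_ (by positivity)
  rw [PiLp.smul_apply, smul_eq_mul, abs_mul]
  exact le_mul_of_one_le_left (abs_nonneg _) (hs.trans (le_abs_self s))

lemma le_quasiNorm_of_annulus_ne_zero (hκ : ∀ l, 0 < κ l) {ξ : EuclideanSpace ℝ (Fin n)}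
    (h : annulus κ ξ ≠ 0) : (1 / (2 * (n + 1)) : ℝ) ≤ quasiNorm κ ξ := by
  have hnorm := one_lt_norm_dilation_of_annulus_ne_zero hκ h
  have hdil := quasiNorm_dilation hκ zero_le_two ξ
  have hq := quasiNorm_nonneg (κ := κ) ξ
  rw [div_le_iff₀ (by positivity)]
  rcases le_total (quasiNorm κ (dilation κ 2 ξ)) 1 with hle | hge
  · have hle' := norm_le_of_quasiNorm_le_one hκ hle
    rw [hdil] at hle'
    linarith
  · rw [hdil] at hge
    nlinarith [Nat.cast_nonneg (α := ℝ) n]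

/-- The lower bound for a symbol of degree `m` and ellipticity constant `lam` on the support of
`annulus`. -/
def symbolLowerBound (n m : ℕ) (lam : ℝ) : ℝ :=
  lam * (1 / (2 * (n + 1)) : ℝ) ^ m

lemma symbolLowerBound_pos {lam : ℝ} (h : 0 < lam) : 0 < symbolLowerBound n m lam :=
  mul_pos h (by positivity)

/-- The reciprocal of the symbol `p`, localised to the dyadic annulus. Mathlib's Fourier transform
turns `∂_l` into multiplication by `2πi ξ_l`, so that `p` is evaluated at `2πξ`. -/
def cutReciprocal (κ : Fin n → ℕ) {r : ℝ} (hr : 0 < r) (p : EuclideanSpace ℝ (Fin n) → ℂ)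
    (ξ : EuclideanSpace ℝ (Fin n)) : ℂ :=
  annulus κ ξ * smoothInv hr (p ((2 * Real.pi) • ξ))

lemma mul_cutReciprocal_dilation (hκ : ∀ l, 0 < κ l) {lam : ℝ} (hlam : 0 < lam)
    {p : EuclideanSpace ℝ (Fin n) → ℂ} (hp : ∀ ξ, lam * quasiNorm κ ξ ^ m ≤ ‖p ξ‖)
    (hom : ∀ (t : ℝ) ξ, p (dilation κ t ξ) = (t : ℂ) ^ m * p ξ) (t : ℝ)
    (ξ : EuclideanSpace ℝ (Fin n)) :
    p ((2 * Real.pi) • ξ) * ((t : ℂ) ^ m *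
      cutReciprocal κ (symbolLowerBound_pos (n := n) (m := m) hlam) p (dilation κ t ξ)) =
        annulus κ (dilation κ t ξ) := by
  have hr := symbolLowerBound_pos (n := n) (m := m) hlam
  by_cases h : annulus κ (dilation κ t ξ) = 0
  · rw [cutReciprocal, h, zero_mul, mul_zero, mul_zero]
  have hle : symbolLowerBound n m lam ≤ ‖p ((2 * Real.pi) • dilation κ t ξ)‖ := by
    refine le_trans ?_ (hp _)
    rw [symbolLowerBound]
    gcongr
    exact (le_quasiNorm_of_annulus_ne_zero hκ h).trans
      (quasiNorm_le_quasiNorm_smul (by linarith [Real.pi_gt_three]) _)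
  have hne : p ((2 * Real.pi) • dilation κ t ξ) ≠ 0 := norm_pos_iff.1 (hr.trans_le hle)
  have hpt : (t : ℂ) ^ m * p ((2 * Real.pi) • ξ) = p ((2 * Real.pi) • dilation κ t ξ) := by
    rw [← hom, map_smul]
  rw [cutReciprocal, smoothInv_of_le hr hle, mul_left_comm, mul_left_comm (p _), ← mul_assoc,
    mul_comm (_ ^ m), mul_assoc, ← mul_assoc (_ ^ m), hpt, mul_inv_cancel₀ hne, mul_one]

lemma contDiff_multiplier_uncurry {r : ℝ} (hr : 0 < r) (γ : Fin n → ℕ) :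
    ContDiff ℝ ∞ fun q : (weightedIndices κ m → ℂ) × EuclideanSpace ℝ (Fin n) =>
      imagMonomial γ ((2 * Real.pi) • q.2) * cutReciprocal κ hr (homSymbol q.1) q.2 := by
  have hs : ContDiff ℝ ∞ fun q : (weightedIndices κ m → ℂ) × EuclideanSpace ℝ (Fin n) =>
      (2 * Real.pi) • q.2 := contDiff_snd.const_smul _
  refine ((contDiff_imagMonomial γ).comp hs).mul ?_
  refine (contDiff_annulus.comp contDiff_snd).mul ((contDiff_smoothInv hr).comp ?_)
  exact contDiff_homSymbol_uncurry.comp (contDiff_fst.prodMk hs)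

lemma exists_kernels (hκ : ∀ l, 0 < κ l) (m : ℕ) {lam : ℝ} (hlam : 0 < lam) (Lam : ℝ) (N : ℕ) :
    ∃ B : ℝ, 0 ≤ B ∧ ∀ c : weightedIndices κ m → ℂ,
      (∀ ξ, ‖homSymbol c ξ‖ ≤ Lam * quasiNorm κ ξ ^ m) →
      ∀ γ ∈ weightedIndices κ m, ∃ k : 𝓢(EuclideanSpace ℝ (Fin n), ℂ),
        (∀ ξ, (𝓕 k) ξ = imagMonomial γ ((2 * Real.pi) • ξ) *
          cutReciprocal κ (symbolLowerBound_pos (n := n) (m := m) hlam) (homSymbol c) ξ) ∧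
        ∀ y, (1 + ‖y‖) ^ N * ‖k y‖ ≤ B ∧ (1 + ‖y‖) ^ N * ‖fderiv ℝ k y‖ ≤ B := by
  have hr := symbolLowerBound_pos (n := n) (m := m) hlam
  obtain ⟨R, hR⟩ := exists_norm_coeff_le κ m Lam
  choose b hb using fun γ : Fin n → ℕ =>
    exists_uniform_kernels (contDiff_multiplier_uncurry (κ := κ) (m := m) hr γ) (ρ := 2)
      (fun c ξ h => by simp only [cutReciprocal, annulus_of_le_norm hκ h, zero_mul, mul_zero]) R N
  obtain ⟨B, hB⟩ := (insert 0 ((weightedIndices κ m).image b)).exists_le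
  refine ⟨B, hB 0 (Finset.mem_insert_self _ _), fun c hc γ hγ => ?_⟩
  obtain ⟨k, hk, hkb⟩ := hb γ c (hR c hc)
  have hbB := hB (b γ) (Finset.mem_insert_of_mem (Finset.mem_image_of_mem b hγ))
  exact ⟨k, hk, fun y => ⟨(hkb y).1.trans hbB, (hkb y).2.trans hbB⟩⟩

end kernel

section fourierPairing

variable {n : ℕ} {κ : Fin n → ℕ}

/-- The multiplier operator `χ ↦ k̂(δ_t ·) χ`; on the Fourier side it is the convolution with the
dilated kernel `k`. -/
def dilatedMultiplier (κ : Fin n → ℕ) (k : 𝓢(EuclideanSpace ℝ (Fin n), ℂ)) (t : ℝ) :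
    𝓢(EuclideanSpace ℝ (Fin n), ℂ) →L[ℂ] 𝓢(EuclideanSpace ℝ (Fin n), ℂ) :=
  SchwartzMap.smulLeftCLM ℂ fun ξ => (𝓕 k) (dilation κ t ξ)

lemma dilatedMultiplier_apply (k χ : 𝓢(EuclideanSpace ℝ (Fin n), ℂ)) (t : ℝ)
    (ξ : EuclideanSpace ℝ (Fin n)) :
    dilatedMultiplier κ k t χ ξ = (𝓕 k) (dilation κ t ξ) * χ ξ :=
  SchwartzMap.smulLeftCLM_apply_apply
    ((SchwartzMap.hasTemperateGrowth _).comp (dilation κ t).hasTemperateGrowth) _ _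

lemma integral_mul_fourier_dilation {k g : EuclideanSpace ℝ (Fin n) → ℂ} (hk : Integrable k)
    (hg : Integrable g) (t : ℝ) :
    ∫ y, k y * 𝓕 g (dilation κ t y) = ∫ ξ, 𝓕 k (dilation κ t ξ) * g ξ := by
  let L : EuclideanSpace ℝ (Fin n) →ₗ[ℝ] EuclideanSpace ℝ (Fin n) →ₗ[ℝ] ℝ :=
    (innerₗ (EuclideanSpace ℝ (Fin n))).compl₂ (dilation κ t).toLinearMap
  have hL : ∀ y ξ, L y ξ = inner ℝ y (dilation κ t ξ) := fun _ _ => rfl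
  have hLc : Continuous fun p : EuclideanSpace ℝ (Fin n) × EuclideanSpace ℝ (Fin n) =>
      L p.1 p.2 := by
    simp only [hL]
    fun_prop
  have hflip := VectorFourier.integral_bilin_fourierIntegral_eq_flip
    (ContinuousLinearMap.mul ℂ ℂ) (L := L) Real.continuous_fourierChar hLc hk hg
  simp only [VectorFourier.fourierIntegral, ContinuousLinearMap.mul_apply', LinearMap.flip_apply,
    hL] at hflip
  have hinner : ∀ v y : EuclideanSpace ℝ (Fin n),
      inner ℝ v (dilation κ t y) = inner ℝ y (dilation κ t v) := fun v y => by
    rw [real_inner_comm, inner_dilation_left]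
  simp only [Real.fourier_eq, hflip]
  refine integral_congr_ae (Eventually.of_forall fun y => ?_)
  simp only [hinner _ y]

lemma fourier_add (χ : EuclideanSpace ℝ (Fin n) → ℂ) (z w : EuclideanSpace ℝ (Fin n)) :
    𝓕 χ (z + w) = 𝓕 (fun ξ => Real.fourierChar (-inner ℝ ξ z) • χ ξ) w := by
  simp only [Real.fourier_eq, smul_smul, ← AddChar.map_add_eq_mul, inner_add_right, neg_add,
    add_comm]

lemma integral_mul_fourier_add_dilation (k χ : 𝓢(EuclideanSpace ℝ (Fin n), ℂ)) (t : ℝ)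
    (z : EuclideanSpace ℝ (Fin n)) :
    ∫ y, k y * (𝓕 χ) (z + dilation κ t y) = (𝓕 (dilatedMultiplier κ k t χ)) z := by
  have hmod : Integrable fun ξ => Real.fourierChar (-inner ℝ ξ z) • χ ξ := by
    refine (χ.integrable (μ := volume)).mono (Continuous.aestronglyMeasurable ?_)
      (Eventually.of_forall fun ξ => (Circle.norm_smul _ _).le)
    exact (continuous_subtype_val.comp
      (Real.continuous_fourierChar.comp (by fun_prop))).smul χ.continuous
  simp only [SchwartzMap.fourier_coe, fourier_add]
  rw [integral_mul_fourier_dilation k.integrable hmod, Real.fourier_eq]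
  refine integral_congr_ae (Eventually.of_forall fun ξ => ?_)
  simp only [dilatedMultiplier_apply, SchwartzMap.fourier_coe, mul_smul_comm]

variable {f : EuclideanSpace ℝ (Fin n) → ℂ}

lemma integrable_prod_mul_sub_dilation (k χ : 𝓢(EuclideanSpace ℝ (Fin n), ℂ))
    (hc : Continuous f) (hf : PolynomialGrowth f) (t : ℝ) :
    Integrable (fun p : EuclideanSpace ℝ (Fin n) × EuclideanSpace ℝ (Fin n) =>
      k p.1 * f (p.2 - dilation κ t p.1) * χ p.2) (volume.prod volume) := by
  obtain ⟨K, N, hK⟩ := hf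
  have hbound := ((integrable_norm_mul_one_add_pow k N).mul_prod
    (integrable_norm_mul_one_add_pow χ N)).const_mul (|K| * (1 + ‖dilation κ t‖) ^ N)
  refine hbound.mono' (Continuous.aestronglyMeasurable (by fun_prop))
    (Eventually.of_forall fun ⟨y, x⟩ => ?_)
  calc ‖k y * f (x - dilation κ t y) * χ x‖
      ≤ ‖k y‖ * (|K| * ((1 + ‖x‖) * ((1 + ‖dilation κ t‖) * (1 + ‖y‖))) ^ N) * ‖χ x‖ := by
        rw [norm_mul, norm_mul]
        gcongr
        refine (hK _).trans ?_
        gcongr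
        · exact le_abs_self K
        · exact one_add_norm_sub_dilation_le t x y
    _ = |K| * (1 + ‖dilation κ t‖) ^ N * (‖k y‖ * (1 + ‖y‖) ^ N * (‖χ x‖ * (1 + ‖x‖) ^ N)) := by
        rw [mul_pow, mul_pow]
        ring

lemma measurePreserving_shear (t : ℝ) :
    MeasurePreserving (fun p : EuclideanSpace ℝ (Fin n) × EuclideanSpace ℝ (Fin n) =>
      (p.1, p.2 + dilation κ t p.1)) (volume.prod volume) (volume.prod volume) :=
  (MeasurePreserving.id volume).skew_product (g := fun y z => z + dilation κ t y)
    (by fun_prop) (Eventually.of_forall fun y => map_add_right_eq_self volume (dilation κ t y))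

lemma integrable_dilationConv_mul (k χ : 𝓢(EuclideanSpace ℝ (Fin n), ℂ)) (hc : Continuous f)
    (hf : PolynomialGrowth f) (t : ℝ) :
    Integrable fun x => dilationConv κ k f t x * χ x := by
  simpa only [dilationConv, integral_mul_const] using
    (integrable_prod_mul_sub_dilation k χ hc hf t).integral_prod_right

lemma integral_dilationConv_mul_fourier (k χ : 𝓢(EuclideanSpace ℝ (Fin n), ℂ))
    (hc : Continuous f) (hf : PolynomialGrowth f) (t : ℝ) :
    ∫ x, dilationConv κ k f t x * (𝓕 χ) x = ∫ z, (𝓕 (dilatedMultiplier κ k t χ)) z * f z := by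
  have hint := integrable_prod_mul_sub_dilation (κ := κ) k (𝓕 χ) hc hf t
  have hshear : Integrable (fun p : EuclideanSpace ℝ (Fin n) × EuclideanSpace ℝ (Fin n) =>
      k p.1 * f p.2 * (𝓕 χ) (p.2 + dilation κ t p.1)) (volume.prod volume) :=
    ((measurePreserving_shear (κ := κ) t).integrable_comp_of_integrable hint).congr
      (Eventually.of_forall fun p => by simp only [Function.comp_apply, add_sub_cancel_right])
  calc ∫ x, dilationConv κ k f t x * (𝓕 χ) x
      = ∫ x, ∫ y, k y * f (x - dilation κ t y) * (𝓕 χ) x := by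
        simp only [dilationConv, integral_mul_const]
    _ = ∫ y, ∫ x, k y * f (x - dilation κ t y) * (𝓕 χ) x := (integral_integral_swap hint).symm
    _ = ∫ y, ∫ z, k y * f z * (𝓕 χ) (z + dilation κ t y) := by
        congr with y
        rw [← integral_add_right_eq_self _ (dilation κ t y)]
        simp only [add_sub_cancel_right]
    _ = ∫ z, ∫ y, k y * f z * (𝓕 χ) (z + dilation κ t y) := integral_integral_swap hshear
    _ = ∫ z, (𝓕 (dilatedMultiplier κ k t χ)) z * f z := by
        simp only [← integral_mul_fourier_add_dilation, ← integral_mul_const, mul_right_comm]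

end fourierPairing

section distribution

variable {n : ℕ} {κ : Fin n → ℕ} {m : ℕ}

lemma imagMonomial_two_pi (γ : Fin n → ℕ) (ξ : EuclideanSpace ℝ (Fin n)) :
    imagMonomial γ ((2 * Real.pi) • ξ) =
      ((List.finRange n).map fun l => (2 * Real.pi * Complex.I * (ξ l : ℂ)) ^ γ l).prod := by
  rw [imagMonomial, ← Fin.prod_univ_def]
  refine Finset.prod_congr rfl fun l _ => ?_
  rw [PiLp.smul_apply, smul_eq_mul]
  push_cast
  ring

lemma hasTemperateGrowth_coord_pow (l : Fin n) (i : ℕ) :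
    (fun ξ : EuclideanSpace ℝ (Fin n) =>
      (2 * Real.pi * Complex.I * (ξ l : ℂ)) ^ i).HasTemperateGrowth := by
  have hcoord := hasTemperateGrowth_coord l
  exact Function.HasTemperateGrowth.pow (by fun_prop) i

lemma hasTemperateGrowth_listProd (γ : Fin n → ℕ) (s : List (Fin n)) :
    (fun ξ : EuclideanSpace ℝ (Fin n) =>
      (s.map fun l => (2 * Real.pi * Complex.I * (ξ l : ℂ)) ^ γ l).prod).HasTemperateGrowth := by
  induction s with
  | nil =>
    simp only [List.map_nil, List.prod_nil]
    fun_prop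
  | cons l s ih =>
    simp only [List.map_cons, List.prod_cons]
    exact (hasTemperateGrowth_coord_pow l _).mul ih

lemma hasTemperateGrowth_imagMonomial (γ : Fin n → ℕ) :
    (fun ξ : EuclideanSpace ℝ (Fin n) =>
      imagMonomial γ ((2 * Real.pi) • ξ)).HasTemperateGrowth := by
  simp only [imagMonomial_two_pi]
  exact hasTemperateGrowth_listProd γ _

lemma lineDerivOp_single_apply_fourier (w : 𝓢'(EuclideanSpace ℝ (Fin n), ℂ)) (l : Fin n)
    (χ : 𝓢(EuclideanSpace ℝ (Fin n), ℂ)) :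
    (∂_{EuclideanSpace.single l (1 : ℝ)} w) (𝓕 χ) =
      w (𝓕 (SchwartzMap.smulLeftCLM ℂ (fun ξ => 2 * Real.pi * Complex.I * (ξ l : ℂ)) χ)) := by
  have hcoord := hasTemperateGrowth_coord l
  rw [TemperedDistribution.lineDerivOp_apply_apply, SchwartzMap.lineDerivOp_fourier_eq,
    neg_smul, FourierTransform.fourier_neg, neg_neg]
  congr 2
  ext x
  rw [smul_apply, SchwartzMap.smulLeftCLM_apply_apply (by fun_prop),
    SchwartzMap.smulLeftCLM_apply_apply (by fun_prop)]
  simp [EuclideanSpace.inner_single_right, mul_assoc]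

lemma iterate_lineDerivOp_single_apply_fourier (w : 𝓢'(EuclideanSpace ℝ (Fin n), ℂ)) (l : Fin n)
    (i : ℕ) (χ : 𝓢(EuclideanSpace ℝ (Fin n), ℂ)) :
    ((fun w : 𝓢'(EuclideanSpace ℝ (Fin n), ℂ) =>
      ∂_{EuclideanSpace.single l (1 : ℝ)} w)^[i] w) (𝓕 χ) =
      w (𝓕 (SchwartzMap.smulLeftCLM ℂ
        (fun ξ => (2 * Real.pi * Complex.I * (ξ l : ℂ)) ^ i) χ)) := by
  have hcoord := hasTemperateGrowth_coord l
  induction i generalizing χ with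
  | zero => simp
  | succ i ih =>
    rw [Function.iterate_succ_apply', lineDerivOp_single_apply_fourier, ih,
      SchwartzMap.smulLeftCLM_smulLeftCLM_apply (hasTemperateGrowth_coord_pow l i) (by fun_prop)]
    simp only [pow_succ, Pi.mul_def]

/-- The multiplier of `D^γ` on the Fourier side, acting on test functions. -/
def derivMultiplier (γ : Fin n → ℕ) :
    𝓢(EuclideanSpace ℝ (Fin n), ℂ) →L[ℂ] 𝓢(EuclideanSpace ℝ (Fin n), ℂ) :=
  SchwartzMap.smulLeftCLM ℂ fun ξ => imagMonomial γ ((2 * Real.pi) • ξ)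

lemma derivMultiplier_apply (γ : Fin n → ℕ) (χ : 𝓢(EuclideanSpace ℝ (Fin n), ℂ))
    (ξ : EuclideanSpace ℝ (Fin n)) :
    derivMultiplier γ χ ξ = imagMonomial γ ((2 * Real.pi) • ξ) * χ ξ :=
  SchwartzMap.smulLeftCLM_apply_apply (hasTemperateGrowth_imagMonomial γ) _ _

lemma multiDeriv_apply_fourier (γ : Fin n → ℕ) (w : 𝓢'(EuclideanSpace ℝ (Fin n), ℂ))
    (χ : 𝓢(EuclideanSpace ℝ (Fin n), ℂ)) :
    multiDeriv γ w (𝓕 χ) = w (𝓕 (derivMultiplier γ χ)) := by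
  simp only [derivMultiplier, imagMonomial_two_pi, multiDeriv]
  generalize List.finRange n = s
  induction s generalizing χ with
  | nil => simp
  | cons l s ih =>
    rw [List.foldr_cons, iterate_lineDerivOp_single_apply_fourier, ih,
      SchwartzMap.smulLeftCLM_smulLeftCLM_apply (hasTemperateGrowth_listProd γ s)
        (hasTemperateGrowth_coord_pow l _)]
    simp only [List.map_cons, List.prod_cons, Pi.mul_def, mul_comm]

lemma constCoeffOp_apply_fourier {𝒜 ℬ : Finset (Fin n → ℕ)} {a : (Fin n → ℕ) → (Fin n → ℕ) → ℂ}
    (u : 𝓢'(EuclideanSpace ℝ (Fin n), ℂ)) {χ ψ : 𝓢(EuclideanSpace ℝ (Fin n), ℂ)}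
    (h : ∀ ξ, ψ ξ = symbol 𝒜 ℬ a ((2 * Real.pi) • ξ) * χ ξ) :
    constCoeffOp 𝒜 ℬ a u (𝓕 χ) = u (𝓕 ψ) := by
  have hψ : ψ = ∑ α ∈ 𝒜, ∑ β ∈ ℬ, a α β • derivMultiplier (α + β) χ := by
    ext ξ
    simp only [h, symbol, sum_apply, smul_apply, derivMultiplier_apply, imagMonomial,
      Finset.sum_mul, smul_eq_mul, mul_assoc, Pi.add_apply]
  have h𝓕 (φ : 𝓢(EuclideanSpace ℝ (Fin n), ℂ)) :
      𝓕 φ = FourierTransform.fourierCLM ℂ 𝓢(EuclideanSpace ℝ (Fin n), ℂ) φ := rfl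
  rw [constCoeffOp, hψ]
  simp only [sum_apply, smul_apply, multiDeriv_apply_fourier]
  simp only [h𝓕, map_sum, map_smul]

lemma hasTemperateGrowth_annulus_dilation (t : ℝ) :
    (fun ξ => annulus κ (dilation κ t ξ)).HasTemperateGrowth :=
  ((hasTemperateGrowth_lowPass 1).sub (hasTemperateGrowth_lowPass 2)).comp
    (dilation κ t).hasTemperateGrowth

lemma hasTemperateGrowth_cutReciprocal_dilation (hκ : ∀ l, 0 < κ l) {r : ℝ} (hr : 0 < r)
    {p : EuclideanSpace ℝ (Fin n) → ℂ} (hp : ContDiff ℝ ∞ p) (t : ℝ) :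
    (fun ξ => cutReciprocal κ hr p (dilation κ t ξ)).HasTemperateGrowth := by
  have hcpt : HasCompactSupport (cutReciprocal κ hr p) :=
    .intro (isCompact_closedBall 0 2) fun ξ hξ => by
      rw [cutReciprocal, annulus_of_le_norm hκ (not_le.1 (by simpa using hξ)).le, zero_mul]
  have hsm : ContDiff ℝ ∞ (cutReciprocal κ hr p) :=
    contDiff_annulus.mul ((contDiff_smoothInv hr).comp (hp.comp (contDiff_id.const_smul _)))
  exact (hcpt.hasTemperateGrowth hsm).comp (dilation κ t).hasTemperateGrowth

/-- The operator on test functions which divides by the symbol `p` on the annulus at scale `t`. The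
factor `t ^ m` undoes the scaling of `p`, which is homogeneous of degree `m`. -/
def annulusParametrix (κ : Fin n → ℕ) (m : ℕ) {r : ℝ} (hr : 0 < r)
    (p : EuclideanSpace ℝ (Fin n) → ℂ) (t : ℝ) :
    𝓢(EuclideanSpace ℝ (Fin n), ℂ) →L[ℂ] 𝓢(EuclideanSpace ℝ (Fin n), ℂ) :=
  (t : ℂ) ^ m • SchwartzMap.smulLeftCLM ℂ fun ξ => cutReciprocal κ hr p (dilation κ t ξ)

lemma annulusParametrix_apply (hκ : ∀ l, 0 < κ l) {r : ℝ} (hr : 0 < r)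
    {p : EuclideanSpace ℝ (Fin n) → ℂ} (hp : ContDiff ℝ ∞ p) (t : ℝ)
    (χ : 𝓢(EuclideanSpace ℝ (Fin n), ℂ)) (ξ : EuclideanSpace ℝ (Fin n)) :
    annulusParametrix κ m hr p t χ ξ =
      (t : ℂ) ^ m * cutReciprocal κ hr p (dilation κ t ξ) * χ ξ := by
  rw [annulusParametrix, smul_apply, smul_apply, SchwartzMap.smulLeftCLM_apply_apply
    (hasTemperateGrowth_cutReciprocal_dilation hκ hr hp t), smul_eq_mul, smul_eq_mul, mul_assoc]

lemma dilatedMultiplier_eq_derivMultiplier (hκ : ∀ l, 0 < κ l) {r : ℝ} (hr : 0 < r)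
    {p : EuclideanSpace ℝ (Fin n) → ℂ} (hp : ContDiff ℝ ∞ p) {α β : Fin n → ℕ}
    (hαβ : weightedOrder κ (α + β) = m) {k : 𝓢(EuclideanSpace ℝ (Fin n), ℂ)}
    (hk : ∀ ξ, (𝓕 k) ξ = imagMonomial (α + β) ((2 * Real.pi) • ξ) * cutReciprocal κ hr p ξ)
    (t : ℝ) (χ : 𝓢(EuclideanSpace ℝ (Fin n), ℂ)) :
    dilatedMultiplier κ k t χ =
      derivMultiplier β (derivMultiplier α (annulusParametrix κ m hr p t χ)) := by
  ext ξ
  rw [dilatedMultiplier_apply, hk, derivMultiplier_apply, derivMultiplier_apply,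
    annulusParametrix_apply hκ hr hp, ← map_smul, imagMonomial_dilation, hαβ, imagMonomial_add]
  ring

lemma sum_apply_dilatedMultiplier (hκ : ∀ l, 0 < κ l) {𝒜 ℬ : Finset (Fin n → ℕ)} {lam : ℝ}
    (hlam : 0 < lam) {a : (Fin n → ℕ) → (Fin n → ℕ) → ℂ} (hsm : ContDiff ℝ ∞ (symbol 𝒜 ℬ a))
    (hp : ∀ ξ, lam * quasiNorm κ ξ ^ m ≤ ‖symbol 𝒜 ℬ a ξ‖)
    (hom : ∀ (t : ℝ) ξ, symbol 𝒜 ℬ a (dilation κ t ξ) = (t : ℂ) ^ m * symbol 𝒜 ℬ a ξ)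
    {u : 𝓢'(EuclideanSpace ℝ (Fin n), ℂ)}
    {F : (Fin n → ℕ) → 𝓢'(EuclideanSpace ℝ (Fin n), ℂ)}
    (hu : constCoeffOp 𝒜 ℬ a u = ∑ β ∈ ℬ, multiDeriv β (F β))
    {α : Fin n → ℕ} (hα : ∀ β ∈ ℬ, weightedOrder κ (α + β) = m)
    {k : (Fin n → ℕ) → 𝓢(EuclideanSpace ℝ (Fin n), ℂ)}
    (hk : ∀ β ∈ ℬ, ∀ ξ, (𝓕 (k β)) ξ = imagMonomial (α + β) ((2 * Real.pi) • ξ) *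
      cutReciprocal κ (symbolLowerBound_pos (n := n) (m := m) hlam) (symbol 𝒜 ℬ a) ξ)
    (t : ℝ) (χ : 𝓢(EuclideanSpace ℝ (Fin n), ℂ)) :
    ∑ β ∈ ℬ, F β (𝓕 (dilatedMultiplier κ (k β) t χ)) =
      multiDeriv α u (𝓕 (SchwartzMap.smulLeftCLM ℂ
        (fun ξ => annulus κ (dilation κ t ξ)) χ)) := by
  have hr := symbolLowerBound_pos (n := n) (m := m) hlam
  let Θ := derivMultiplier α (annulusParametrix κ m hr (symbol 𝒜 ℬ a) t χ)
  calc ∑ β ∈ ℬ, F β (𝓕 (dilatedMultiplier κ (k β) t χ))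
      = ∑ β ∈ ℬ, multiDeriv β (F β) (𝓕 Θ) := Finset.sum_congr rfl fun β hβ => by
        rw [multiDeriv_apply_fourier,
          dilatedMultiplier_eq_derivMultiplier hκ hr hsm (hα β hβ) (hk β hβ)]
    _ = constCoeffOp 𝒜 ℬ a u (𝓕 Θ) := by rw [hu, sum_apply]
    _ = u (𝓕 (derivMultiplier α (SchwartzMap.smulLeftCLM ℂ
        (fun ξ => annulus κ (dilation κ t ξ)) χ))) := constCoeffOp_apply_fourier u fun ξ => by
        rw [derivMultiplier_apply, derivMultiplier_apply, annulusParametrix_apply hκ hr hsm,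
          SchwartzMap.smulLeftCLM_apply_apply (hasTemperateGrowth_annulus_dilation t),
          ← mul_cutReciprocal_dilation hκ hlam hp hom, smul_eq_mul]
        ring
    _ = _ := (multiDeriv_apply_fourier α u _).symm

end distribution

section reconstruction

variable {n : ℕ} {κ : Fin n → ℕ}

/-- A tempered distribution as a functional of the Fourier transform of the test function. -/
def fourierPullback (T : 𝓢'(EuclideanSpace ℝ (Fin n), ℂ)) :
    𝓢(EuclideanSpace ℝ (Fin n), ℂ) →L[ℂ] ℂ where
  toFun χ := T (𝓕 χ)
  map_add' χ₁ χ₂ := by rw [FourierTransform.fourier_add, map_add]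
  map_smul' c χ := by rw [FourierTransform.fourier_smul, map_smul]; rfl
  cont := (map_continuous T).comp
    (FourierTransform.fourierCLM ℂ 𝓢(EuclideanSpace ℝ (Fin n), ℂ)).continuous

lemma fourierPullback_apply (T : 𝓢'(EuclideanSpace ℝ (Fin n), ℂ))
    (χ : 𝓢(EuclideanSpace ℝ (Fin n), ℂ)) : fourierPullback T χ = T (𝓕 χ) := rfl

/-- Integration of the Fourier transform of the test function against `g`, as a functional of the
test function. -/
def fourierIntegral {g : EuclideanSpace ℝ (Fin n) → ℂ}
    (hg : ∀ φ : 𝓢(EuclideanSpace ℝ (Fin n), ℂ), Integrable fun x => φ x * g x) :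
    𝓢(EuclideanSpace ℝ (Fin n), ℂ) →ₗ[ℂ] ℂ where
  toFun χ := ∫ x, (𝓕 χ) x * g x
  map_add' χ₁ χ₂ := by
    rw [FourierTransform.fourier_add, ← integral_add (hg _) (hg _)]
    simp only [add_apply, add_mul]
  map_smul' c χ := by
    rw [FourierTransform.fourier_smul, RingHom.id_apply, smul_eq_mul, ← integral_const_mul]
    simp only [smul_apply, smul_eq_mul, mul_assoc]

lemma integral_fourier (χ : 𝓢(EuclideanSpace ℝ (Fin n), ℂ)) : ∫ x, (𝓕 χ) x = χ 0 := by
  rw [← fourierInv_apply_zero, FourierTransform.fourierInv_fourier_eq]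

lemma integral_eq_fourier_zero (k : 𝓢(EuclideanSpace ℝ (Fin n), ℂ)) : ∫ y, k y = (𝓕 k) 0 := by
  rw [SchwartzMap.fourier_coe, Real.fourier_eq]
  simp

lemma sum_smulLeftCLM_annulus (J : ℕ) (χ : 𝓢(EuclideanSpace ℝ (Fin n), ℂ)) :
    ∑ j ∈ Finset.Ico (-J : ℤ) J,
        SchwartzMap.smulLeftCLM ℂ (fun ξ => annulus κ (dilation κ (2 ^ j) ξ)) χ =
      SchwartzMap.smulLeftCLM ℂ (bandPass κ J) χ := by
  ext ξ
  simp only [sum_apply, SchwartzMap.smulLeftCLM_apply_apply (hasTemperateGrowth_bandPass J),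
    SchwartzMap.smulLeftCLM_apply_apply (hasTemperateGrowth_annulus_dilation _), smul_eq_mul,
    ← sum_annulus_dilation, Finset.sum_mul]

lemma tendsto_Ico_neg_natCast_atTop :
    Tendsto (fun J : ℕ => Finset.Ico (-J : ℤ) J) atTop atTop := by
  refine tendsto_atTop_finset_of_monotone (fun J J' hJ => ?_) fun j => ⟨j.natAbs + 1, ?_⟩
  · exact Finset.Ico_subset_Ico (by omega) (by omega)
  · rw [Finset.mem_Ico]; omega

/-- The functions `h j` represent the anisotropic Littlewood–Paley pieces of `T`. -/
def IsDyadicDecomposition (κ : Fin n → ℕ) (T : 𝓢'(EuclideanSpace ℝ (Fin n), ℂ))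
    (h : ℤ → EuclideanSpace ℝ (Fin n) → ℂ) : Prop :=
  ∀ (j : ℤ) (χ : 𝓢(EuclideanSpace ℝ (Fin n), ℂ)), Integrable (fun x => h j x * (𝓕 χ) x) ∧
    ∫ x, h j x * (𝓕 χ) x = fourierPullback T (SchwartzMap.smulLeftCLM ℂ
      (fun ξ => annulus κ (dilation κ (2 ^ j) ξ)) χ)

namespace IsDyadicDecomposition

variable {T : 𝓢'(EuclideanSpace ℝ (Fin n), ℂ)} {h : ℤ → EuclideanSpace ℝ (Fin n) → ℂ} {w : ℤ → ℝ}

lemma integral_fourier_mul_sub (hT : IsDyadicDecomposition κ T h)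
    {χ : 𝓢(EuclideanSpace ℝ (Fin n), ℂ)} (hχ : χ 0 = 0) (j : ℤ) :
    ∫ x, (𝓕 χ) x * (h j x - h j 0) = fourierPullback T (SchwartzMap.smulLeftCLM ℂ
      (fun ξ => annulus κ (dilation κ (2 ^ j) ξ)) χ) := by
  calc ∫ x, (𝓕 χ) x * (h j x - h j 0)
      = (∫ x, h j x * (𝓕 χ) x) - h j 0 * ∫ x, (𝓕 χ) x := by
        rw [← integral_const_mul, ← integral_sub (hT j χ).1 ((𝓕 χ).integrable.const_mul _)]
        congr 1 with x
        ring
    _ = _ := by rw [integral_fourier, hχ, mul_zero, sub_zero, (hT j χ).2]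

lemma exists_forall_flat (hκ : ∀ l, 0 < κ l) (H : IsDyadicFamily κ h w)
    (hT : IsDyadicDecomposition κ T h) :
    ∃ L, ∀ χ : 𝓢(EuclideanSpace ℝ (Fin n), ℂ), (∀ i < L, iteratedFDeriv ℝ i χ 0 = 0) →
      fourierPullback T χ = ∫ x, (𝓕 χ) x * renormalizedSum h x := by
  obtain ⟨L, hL⟩ := exists_order_tendsto_bandPass hκ (fourierPullback T)
  refine ⟨L + 1, fun χ hχ => ?_⟩
  have hχ0 : χ 0 = 0 := by
    rw [← norm_eq_zero, ← norm_iteratedFDeriv_zero (𝕜 := ℝ), hχ 0 L.succ_pos, norm_zero]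
  have hsum := (H.hasSum_integral hκ (𝓕 χ)).comp tendsto_Ico_neg_natCast_atTop
  simp only [hT.integral_fourier_mul_sub hχ0, Function.comp_def, ← map_sum,
    sum_smulLeftCLM_annulus] at hsum
  exact tendsto_nhds_unique (hL χ fun i hi => hχ i (hi.trans L.lt_succ_self)) hsum

lemma exists_polynomial (hκ : ∀ l, 0 < κ l) (H : IsDyadicFamily κ h w)
    (hT : IsDyadicDecomposition κ T h) :
    ∃ Q : MvPolynomial (Fin n) ℂ, IsRepresentedBy T fun x =>
      renormalizedSum h x + MvPolynomial.eval (fun l => (x l : ℂ)) Q := by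
  have hint := (H.polynomialGrowth_renormalizedSum hκ).integrable_mul
    (H.continuous_renormalizedSum hκ)
  obtain ⟨L, hL⟩ := hT.exists_forall_flat hκ H
  obtain ⟨Q, hQ⟩ := exists_polynomial_of_flat
    ((fourierPullback T).toLinearMap - fourierIntegral hint) L fun χ hχ =>
      sub_eq_zero.2 (hL χ hχ)
  have hQ' (φ : 𝓢(EuclideanSpace ℝ (Fin n), ℂ)) : T φ - ∫ x, φ x * renormalizedSum h x =
      ∫ x, φ x * MvPolynomial.eval (fun l => (x l : ℂ)) Q := by
    rw [← FourierTransform.fourier_fourierInv_eq (F := 𝓢(EuclideanSpace ℝ (Fin n), ℂ)) φ]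
    exact hQ (𝓕⁻ φ)
  refine ⟨Q, fun φ => ?_⟩
  simp only [mul_add]
  refine ⟨(hint φ).add (integrable_mul_eval φ Q), ?_⟩
  rw [integral_add (hint φ) (integrable_mul_eval φ Q), ← hQ', add_sub_cancel]

end IsDyadicDecomposition

end reconstruction

section pieces

variable {n : ℕ} {κ : Fin n → ℕ} {m : ℕ} {ℬ : Finset (Fin n → ℕ)}
  {k : (Fin n → ℕ) → 𝓢(EuclideanSpace ℝ (Fin n), ℂ)}
  {f : (Fin n → ℕ) → EuclideanSpace ℝ (Fin n) → ℂ}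

/-- The part at scale `2^j` of the convolutions of the data `f β` with the kernels `k β`. -/
def dyadicPiece (κ : Fin n → ℕ) (ℬ : Finset (Fin n → ℕ))
    (k : (Fin n → ℕ) → 𝓢(EuclideanSpace ℝ (Fin n), ℂ))
    (f : (Fin n → ℕ) → EuclideanSpace ℝ (Fin n) → ℂ) (j : ℤ) (x : EuclideanSpace ℝ (Fin n)) : ℂ :=
  ∑ β ∈ ℬ, dilationConv κ (k β) (f β) (2 ^ j) x

lemma isDyadicFamily_dyadicPiece (hκ : ∀ l, 0 < κ l)
    (hf : ∀ β ∈ ℬ, Continuous (f β))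
    (hfin : diniBound (oscillation κ ℬ f) 1 ≠ ⊤) {B : ℝ} (hB : 0 ≤ B)
    (hk : ∀ β ∈ ℬ, ∀ y, (1 + ‖y‖) ^ (n + 2) * ‖k β y‖ ≤ B ∧
      (1 + ‖y‖) ^ (n + 2) * ‖fderiv ℝ (k β) y‖ ≤ B)
    (hk0 : ∀ β ∈ ℬ, ∫ y, k β y = 0) :
    IsDyadicFamily κ (dyadicPiece κ ℬ k f) fun j =>
      ℬ.card * dilationConvConst κ B * (oscillation κ ℬ f (2 ^ j)).toReal where
  weight_nonneg _ := mul_nonneg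
    (mul_nonneg (Nat.cast_nonneg _) (dilationConvConst_nonneg hB))
    ENNReal.toReal_nonneg
  summable := by
    simp only [mul_left_comm (min _ _)]
    exact (summable_dyadic oscillation_mono hfin).mul_left _
  norm_sub_le j x y := by
    have hne := zpow_ne_top_of_diniBound_ne_top oscillation_mono hfin j
    rw [dyadicPiece, dyadicPiece, ← Finset.sum_sub_distrib]
    refine (norm_sum_le_of_le ℬ fun β hβ => norm_dilationConv_sub_le hκ (by positivity)
      ENNReal.toReal_nonneg (hf β hβ) (fun _ _ h => norm_sub_le_toReal_oscillation hne hβ h)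
      (k β).differentiable (fun y => (hk β hβ y).1) (fun y => (hk β hβ y).2) (hk0 β hβ)
      x y).trans_eq ?_
    rw [Finset.sum_const, nsmul_eq_mul]
    ring

lemma isDyadicDecomposition_dyadicPiece (hκ : ∀ l, 0 < κ l) {𝒜 : Finset (Fin n → ℕ)} {lam : ℝ}
    (hlam : 0 < lam) {c : weightedIndices κ m → ℂ} {a : (Fin n → ℕ) → (Fin n → ℕ) → ℂ}
    (hc : homSymbol c = symbol 𝒜 ℬ a)
    (ha : ∀ ξ, lam * quasiNorm κ ξ ^ m ≤ ‖symbol 𝒜 ℬ a ξ‖)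
    {u : 𝓢'(EuclideanSpace ℝ (Fin n), ℂ)}
    {F : (Fin n → ℕ) → 𝓢'(EuclideanSpace ℝ (Fin n), ℂ)}
    (hf : ∀ β ∈ ℬ, Continuous (f β) ∧ PolynomialGrowth (f β) ∧ IsRepresentedBy (F β) (f β))
    (hu : constCoeffOp 𝒜 ℬ a u = ∑ β ∈ ℬ, multiDeriv β (F β))
    {α : Fin n → ℕ} (hα : ∀ β ∈ ℬ, weightedOrder κ (α + β) = m)
    (hk : ∀ β ∈ ℬ, ∀ ξ, (𝓕 (k β)) ξ = imagMonomial (α + β) ((2 * Real.pi) • ξ) *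
      cutReciprocal κ (symbolLowerBound_pos (n := n) (m := m) hlam) (homSymbol c) ξ) :
    IsDyadicDecomposition κ (multiDeriv α u) (dyadicPiece κ ℬ k f) := fun j χ => by
  have hint (β) (hβ : β ∈ ℬ) :=
    integrable_dilationConv_mul (κ := κ) (k β) (𝓕 χ) (hf β hβ).1 (hf β hβ).2.1 (2 ^ j)
  have hsm : ContDiff ℝ (⊤ : ℕ∞) (symbol 𝒜 ℬ a) :=
    hc ▸ contDiff_homSymbol_uncurry.comp (contDiff_const.prodMk contDiff_id)
  simp only [dyadicPiece, Finset.sum_mul]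
  refine ⟨integrable_finsetSum _ hint, ?_⟩
  rw [integral_finsetSum _ hint, fourierPullback_apply,
    ← sum_apply_dilatedMultiplier hκ hlam hsm ha
      (fun t ξ => hc ▸ homSymbol_dilation hκ c t ξ) hu hα (hc ▸ hk)]
  refine Finset.sum_congr rfl fun β hβ => ?_
  rw [integral_dilationConv_mul_fourier (k β) χ (hf β hβ).1 (hf β hβ).2.1,
    ((hf β hβ).2.2 _).2]

lemma integral_eq_zero_of_fourier_eq_mul_cutReciprocal {r : ℝ} (hr : 0 < r)
    {p g : EuclideanSpace ℝ (Fin n) → ℂ} {k : 𝓢(EuclideanSpace ℝ (Fin n), ℂ)}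
    (hk : ∀ ξ, (𝓕 k) ξ = g ξ * cutReciprocal κ hr p ξ) : ∫ y, k y = 0 := by
  rw [integral_eq_fourier_zero, hk, cutReciprocal, annulus_zero, zero_mul, mul_zero]

end pieces

end AnisotropicSchauder

end

theorem theorem2p2 (n : ℕ) (κ : Fin n → ℕ) (hκ : ∀ l, 0 < κ l) (m : ℕ)
    (𝒜 ℬ : Finset (Fin n → ℕ))
    (h𝒜ℬ : ∀ α ∈ 𝒜, ∀ β ∈ ℬ, AnisotropicSchauder.weightedOrder κ (α + β) = m)
    (lam Lam : ℝ) (hlam : 0 < lam) :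
    ∃ C : ℝ≥0,
      ∀ a : (Fin n → ℕ) → (Fin n → ℕ) → ℂ,
      (∀ ξ : EuclideanSpace ℝ (Fin n),
        lam * AnisotropicSchauder.quasiNorm κ ξ ^ m ≤ ‖AnisotropicSchauder.symbol 𝒜 ℬ a ξ‖ ∧
        ‖AnisotropicSchauder.symbol 𝒜 ℬ a ξ‖ ≤ Lam * AnisotropicSchauder.quasiNorm κ ξ ^ m) →
      ∀ (u : 𝓢'(EuclideanSpace ℝ (Fin n), ℂ))
        (F : (Fin n → ℕ) → 𝓢'(EuclideanSpace ℝ (Fin n), ℂ))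
        (f : (Fin n → ℕ) → EuclideanSpace ℝ (Fin n) → ℂ),
      (∀ β ∈ ℬ, Continuous (f β) ∧ AnisotropicSchauder.PolynomialGrowth (f β) ∧
        AnisotropicSchauder.IsRepresentedBy (F β) (f β)) →
      AnisotropicSchauder.constCoeffOp 𝒜 ℬ a u
        = ∑ β ∈ ℬ, AnisotropicSchauder.multiDeriv β (F β) →
      (∫⁻ ρ in Ioo (0 : ℝ) 1,
        AnisotropicSchauder.oscillation κ ℬ f ρ / ENNReal.ofReal ρ) < ∞ →
      (∫⁻ ρ in Ioi (1 : ℝ),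
        AnisotropicSchauder.oscillation κ ℬ f ρ / ENNReal.ofReal (ρ ^ 2)) < ∞ →
      ∀ α : Fin n → ℕ, (∀ β ∈ ℬ, AnisotropicSchauder.weightedOrder κ (α + β) = m) →
        ∃ g : EuclideanSpace ℝ (Fin n) → ℂ, Continuous g ∧
          AnisotropicSchauder.IsRepresentedBy (AnisotropicSchauder.multiDeriv α u) g ∧
          ∃ Q : MvPolynomial (Fin n) ℂ, ∀ x y : EuclideanSpace ℝ (Fin n),
            ‖(g x - MvPolynomial.eval (fun l => (x l : ℂ)) Q)
                - (g y - MvPolynomial.eval (fun l => (y l : ℂ)) Q)‖ₑ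
              ≤ C * AnisotropicSchauder.diniBound (AnisotropicSchauder.oscillation κ ℬ f)
                  (AnisotropicSchauder.quasiNorm κ (x - y)) := by
  open AnisotropicSchauder in
  obtain ⟨B, hB, hker⟩ := exists_kernels hκ m hlam Lam (n + 2)
  have hP : 0 ≤ ℬ.card * dilationConvConst κ B :=
    mul_nonneg (Nat.cast_nonneg _) (dilationConvConst_nonneg hB)
  refine ⟨(ℬ.card * dilationConvConst κ B * 4).toNNReal, fun a ha u F f hf hu hd₀ hd₁ α hα => ?_⟩
  obtain ⟨c, hc⟩ := exists_homSymbol_eq_symbol hκ h𝒜ℬ a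
  choose! k hk hkB using fun (β : Fin n → ℕ) (hβ : β ∈ ℬ) =>
    hker c (fun ξ => hc ▸ (ha ξ).2) (α + β) ((mem_weightedIndices hκ).2 (hα β hβ))
  have hfin : diniBound (oscillation κ ℬ f) 1 ≠ ⊤ :=
    ENNReal.add_ne_top.2 ⟨hd₀.ne, ENNReal.mul_ne_top ENNReal.ofReal_ne_top hd₁.ne⟩
  have H := isDyadicFamily_dyadicPiece hκ (fun β hβ => (hf β hβ).1) hfin hB hkB fun β hβ =>
    integral_eq_zero_of_fourier_eq_mul_cutReciprocal _ (hk β hβ)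
  have hT := isDyadicDecomposition_dyadicPiece hκ hlam hc (fun ξ => (ha ξ).1) hf hu hα hk
  obtain ⟨Q, hQ⟩ := hT.exists_polynomial hκ H
  refine ⟨_, ?_, hQ, Q, fun x y => ?_⟩
  · exact (H.continuous_renormalizedSum hκ).add (hasTemperateGrowth_eval Q).1.continuous
  · simp only [add_sub_cancel_right]
    exact H.enorm_renormalizedSum_sub_le hκ hP oscillation_mono hfin x y
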